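/- Let $X\neq\{0\}$ and $U$ be real Hilbert spaces, let $A$ generate a $C_0$ semigroup $(S_t)_{t\ge 0}$ on $X$, let $B\in L(U,X)$, $T>0$, $y_0,y_f\in X$, $E=L^2(0,T;U)$. Let $\mathcal U\subset U$ be bounded with $0\in\mathcal U$. For $K\subset U$ put $\mathrm{cone}(K)=\{\lambda p:\ p\in K,\ \lambda>0\}$; let $P=\mathrm{cone}(\mathcal U)$, $\mathcal U_r=\overline{\mathrm{conv}}(\mathcal U)$, $P_r=\mathrm{cone}(\mathcal U_r)$, and let $P_r^\circ=\{y:\ \langle x,y\rangle\le 0\ \ \forall x\in P_r\}$ be the polar cone. Let $j_{\mathcal U_r}(x)=\inf\{\alpha>0:\ x\in\alpha\,\mathcal U_r\}\in[0,+\infty]$, let $\mathrm{sing}(\mathcal U_r)$ be the set of $v\in U$ for which $\sup_{w\in\mathcal U_r}\langle v,w\rangle$ is reached at more than one point of $\mathcal U_r$, and let $\mathrm{ext}(\mathcal U_r)$ be the set of extreme points. Set $$F(u)=\tfrac12\int_0^T j_{\mathcal U_r}(u(t))^2\,dt\quad(u\in E),\qquad L^2_{\mathcal U_r}=\{u\in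 E:\ F(u)<+\infty\},\qquad L_Tu=\int_0^T S_{T-t}Bu(t)\,dt,$$ let $F^*$ be the convex conjugate of $F$ on $E$, $L_T^*:X\to E$ the adjoint of $L_T\in L(E,X)$, and $\partial F^*$ the subdifferential of $F^*$. Let $\tilde y_T=y_f-S_Ty_0$ and $J_0(p_f)=F^*(L_T^*p_f)-\langle\tilde y_T,p_f\rangle_X$. A control $u\in E$ steers $y_0$ to $y_f$ in time $T$ if the mild solution of $\dot y=Ay+Bu$, $y(0)=y_0$, satisfies $y(T)=y_f$; the state $y_f$ is exactly reachable from $y_0$ in time $T$ under $P_r$ with controls in $L^2_{\mathcal U_r}$ if some $u\in L^2_{\mathcal U_r}$ with $u(t)\in P_r$ for a.e. $t\in(0,T)$ does so. Finally let $$c^\star=\sup_{\|p_f\|_X=1}\frac{\langle\tilde y_T,p_f\rangle_X}{F^*(L_T^*p_f)^{1/2}}=\inf\{c\ge 0:\ \forall p_f\in X,\ \langle\tilde y_T,p_f\rangle_X\le c\,F^*(L_T^*p_f)^{1/2}\}\in[0,+\infty],$$ with $0/0=0$ and $\alpha/0=\pm\infty$ according to the sign of $\alpha\neq0$ (the equality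 of the two expressions is part of the claim); $c^\star$ is attained if the supremum is a maximum. **Theorem.** The state $y_f$ is exactly reachable from $y_0$ in time $T$ under $P_r$ with controls in $L^2_{\mathcal U_r}$ if and only if $$\exists c>0,\ \forall p_f\in X,\quad \langle \tilde y_T,p_f\rangle_X\le c\,F^*(L_T^*p_f)^{1/2},$$ and this condition is equivalent to $c^\star<+\infty$. Assume now that this condition holds. Then $J_0$ admits a minimiser over $X$ if and only if $c^\star$ is attained, and for any minimiser $p_f^\star$ at least one control $u\in\partial F^*(L_T^*p_f^\star)$ steers $y_0$ to $y_f$ in time $T$. Furthermore, consider the condition $$\text{(H)}\qquad L_T^*p_f^\star(t)\notin \mathrm{sing}(\mathcal U_r)\cap (P_r^\circ)^c\quad\text{for a.e. }t\in(0,T).$$ - If (H) holds, then there is a unique control $u\in\partial F^*(L_T^*p_f^\star)$ (which therefore steers $y_0$ to $y_f$). Conversely, if $U$ is separable and there is a unique control in $\partial F^*(L_T^*p_f^\star)$, then (H) holds. - If (H) holds and, in addition, (E): $\mathrm{ext}(\mathcal U_r)\subset\mathcal U$, then this unique control satisfies $u(t)\in P$ for a.e. $t\in(0,T)$. -/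

import Mathlib

open MeasureTheory Set Filter Topology
open scoped NNReal ENNReal RealInnerProductSpace Pointwise

noncomputable section

namespace ConicControl

/-! ## Strongly continuous semigroups -/

/-- A `C₀` semigroup `(S_t)_{t ≥ 0}` of bounded operators. -/
structure C0Semigroup (X : Type*) [NormedAddCommGroup X] [NormedSpace ℝ X] where
  op : ℝ≥0 → X →L[ℝ] X
  op_zero : op 0 = ContinuousLinearMap.id ℝ X
  op_add : ∀ s t, op (s + t) = (op s).comp (op t)
  continuous_orbit : ∀ x, Continuous fun t => op t x

namespace C0Semigroup

variable {X : Type*} [NormedAddCommGroup X] [NormedSpace ℝ X]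

/-- `A` is the infinitesimal generator of `S`: `x ∈ D(A)` and `A x = z` iff
`(S_h x - x) / h → z` as `h → 0⁺`. -/
def IsGenerator (S : C0Semigroup X) (A : X →ₗ.[ℝ] X) : Prop :=
  ∀ x z : X, (x, z) ∈ A.graph ↔
    Tendsto (fun h : ℝ => h⁻¹ • (S.op h.toNNReal x - x)) (𝓝[>] 0) (𝓝 z)

theorem exists_bound [CompleteSpace X] (S : C0Semigroup X) (T : ℝ≥0) :
    ∃ M : ℝ≥0, ∀ t ≤ T, ‖S.op t‖ ≤ M := by
  obtain ⟨C, hC⟩ := banach_steinhaus (g := fun t : Icc (0 : ℝ≥0) T => S.op t) (by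
    intro x
    obtain ⟨C, hC⟩ := (isCompact_Icc (a := (0 : ℝ≥0)) (b := T)).exists_bound_of_continuousOn
      (S.continuous_orbit x).continuousOn
    exact ⟨C, fun t => hC t t.2⟩)
  exact ⟨C.toNNReal, fun t ht => (hC ⟨t, zero_le, ht⟩).trans (Real.le_coe_toNNReal C)⟩

theorem continuous_uncurry [CompleteSpace X] (S : C0Semigroup X) :
    Continuous fun p : ℝ≥0 × X => S.op p.1 p.2 := by
  rw [continuous_iff_continuousAt]
  rintro ⟨t, x⟩
  obtain ⟨M, hM⟩ := S.exists_bound (t + 1)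
  have key : ContinuousOn (fun p : ℝ≥0 × X => S.op p.1 p.2) (Iio (t + 1) ×ˢ univ) := by
    refine continuousOn_prod_of_continuousOn_lipschitzOnWith' _ M ?_ ?_
    · intro s hs
      refine LipschitzWith.lipschitzOnWith ?_
      refine LipschitzWith.of_dist_le_mul fun a b => ?_
      rw [dist_eq_norm, dist_eq_norm, ← map_sub]
      exact (S.op s).le_of_opNorm_le (hM s (le_of_lt hs)) _
    · intro a _
      exact (S.continuous_orbit a).continuousOn
  refine key.continuousAt ?_
  exact prod_mem_nhds (Iio_mem_nhds (by simp)) univ_mem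

end C0Semigroup

/-! ## The linear control system `y' = A y + B u` -/

section System

variable {X U : Type*} [NormedAddCommGroup X] [InnerProductSpace ℝ X] [CompleteSpace X]
  [NormedAddCommGroup U] [InnerProductSpace ℝ U] [CompleteSpace U]

/-- The space `E = L²(0,T;U)`. -/
abbrev ControlSpace (U : Type*) [NormedAddCommGroup U] (T : ℝ) : Type _ :=
  Lp U 2 (volume.restrict (Ioo (0 : ℝ) T))

/-- The (mild) solution of `y' = A y + B u`, `y(0) = y₀`, where `A` generates `S`. -/
def solution (S : C0Semigroup X) (B : U →L[ℝ] X) (y₀ : X) (u : ℝ → U) (t : ℝ) : X :=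
  S.op t.toNNReal y₀ + ∫ s in Ioo 0 t, S.op (t - s).toNNReal (B (u s))

set_option linter.unusedSectionVars false in
theorem integrable_input (S : C0Semigroup X) (B : U →L[ℝ] X) (T : ℝ) (u : ControlSpace U T) :
    Integrable (fun t => S.op (T - t).toNNReal (B (u t))) (volume.restrict (Ioo (0 : ℝ) T)) := by
  obtain ⟨M, hM⟩ := S.exists_bound T.toNNReal
  have hu : Integrable (u : ℝ → U) (volume.restrict (Ioo (0 : ℝ) T)) :=
    (Lp.memLp u).integrable (by norm_num)
  have hc : Continuous fun t : ℝ => (T - t).toNNReal := by fun_prop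
  have hm : AEStronglyMeasurable (fun t => S.op (T - t).toNNReal (B (u t)))
      (volume.restrict (Ioo (0 : ℝ) T)) :=
    S.continuous_uncurry.comp_aestronglyMeasurable
      (hc.aestronglyMeasurable.prodMk (B.continuous.comp_aestronglyMeasurable hu.1))
  refine Integrable.mono' (hu.norm.const_mul (M * ‖B‖)) hm ?_
  refine (ae_restrict_iff' measurableSet_Ioo).2 (Eventually.of_forall fun t ht => ?_)
  have h1 := hM (T - t).toNNReal (Real.toNNReal_le_toNNReal (by linarith [ht.1]))
  calc ‖S.op (T - t).toNNReal (B (u t))‖ ≤ M * ‖B (u t)‖ := (S.op _).le_of_opNorm_le h1 _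
    _ ≤ M * (‖B‖ * ‖u t‖) := by gcongr; exact B.le_opNorm _
    _ = M * ‖B‖ * ‖u t‖ := by ring

/-- The input-to-state map as a linear map. -/
def inputMapLin (S : C0Semigroup X) (B : U →L[ℝ] X) (T : ℝ) : ControlSpace U T →ₗ[ℝ] X where
  toFun u := ∫ t in Ioo 0 T, S.op (T - t).toNNReal (B (u t))
  map_add' u v := by
    rw [← integral_add (integrable_input S B T u) (integrable_input S B T v)]
    refine integral_congr_ae ?_
    filter_upwards [Lp.coeFn_add u v] with t ht
    rw [ht]
    simp
  map_smul' c u := by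
    rw [RingHom.id_apply, ← integral_smul]
    refine integral_congr_ae ?_
    filter_upwards [Lp.coeFn_smul c u] with t ht
    rw [ht]
    simp

theorem inputMapLin_bound (S : C0Semigroup X) (B : U →L[ℝ] X) (T : ℝ) :
    ∃ C : ℝ, ∀ u : ControlSpace U T, ‖inputMapLin S B T u‖ ≤ C * ‖u‖ := by
  obtain ⟨M, hM⟩ := S.exists_bound T.toNNReal
  set μ : Measure ℝ := volume.restrict (Ioo (0 : ℝ) T) with hμ
  set k : ℝ := (μ univ ^ (1 / 2 : ℝ)).toReal with hk
  refine ⟨M * ‖B‖ * k, fun u => ?_⟩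
  have hu : Integrable (u : ℝ → U) μ := (Lp.memLp u).integrable (by norm_num)
  have h1 : ‖inputMapLin S B T u‖ ≤ ∫ t, M * ‖B‖ * ‖u t‖ ∂μ := by
    refine norm_integral_le_of_norm_le (hu.norm.const_mul (M * ‖B‖)) ?_
    refine (ae_restrict_iff' measurableSet_Ioo).2 (Eventually.of_forall fun t ht => ?_)
    have h1 := hM (T - t).toNNReal (Real.toNNReal_le_toNNReal (by linarith [ht.1]))
    calc ‖S.op (T - t).toNNReal (B (u t))‖ ≤ M * ‖B (u t)‖ := (S.op _).le_of_opNorm_le h1 _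
      _ ≤ M * (‖B‖ * ‖u t‖) := by gcongr; exact B.le_opNorm _
      _ = M * ‖B‖ * ‖u t‖ := by ring
  have h2 : ∫ t, ‖u t‖ ∂μ ≤ k * ‖u‖ := by
    have h3 := eLpNorm_le_eLpNorm_mul_rpow_measure_univ (p := 1) (q := 2) (by norm_num)
      (Lp.memLp u).1
    have h4 : (1 / (1 : ℝ≥0∞).toReal - 1 / (2 : ℝ≥0∞).toReal) = (1 / 2 : ℝ) := by norm_num
    rw [h4] at h3
    have h5 : ∫ t, ‖u t‖ ∂μ = (eLpNorm u 1 μ).toReal := by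
      rw [integral_norm_eq_lintegral_enorm hu.1, eLpNorm_one_eq_lintegral_enorm]
    rw [h5, Lp.norm_def, hk, mul_comm, ← ENNReal.toReal_mul]
    refine ENNReal.toReal_mono ?_ h3
    refine ENNReal.mul_ne_top (Lp.eLpNorm_ne_top u) ?_
    exact ENNReal.rpow_ne_top_of_nonneg (by norm_num) (measure_ne_top μ univ)
  calc ‖inputMapLin S B T u‖ ≤ ∫ t, M * ‖B‖ * ‖u t‖ ∂μ := h1
    _ = M * ‖B‖ * ∫ t, ‖u t‖ ∂μ := integral_const_mul _ _
    _ ≤ M * ‖B‖ * (k * ‖u‖) := by gcongr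
    _ = M * ‖B‖ * k * ‖u‖ := by ring

/-- The bounded operator `L_T : L²(0,T;U) → X`, `L_T u = ∫₀ᵀ S_{T-t} B u(t) dt`. -/
def inputMap (S : C0Semigroup X) (B : U →L[ℝ] X) (T : ℝ) : ControlSpace U T →L[ℝ] X :=
  (inputMapLin S B T).mkContinuousOfExistsBound (inputMapLin_bound S B T)

theorem inputMap_apply (S : C0Semigroup X) (B : U →L[ℝ] X) (T : ℝ) (u : ControlSpace U T) :
    inputMap S B T u = ∫ t in Ioo 0 T, S.op (T - t).toNNReal (B (u t)) := rfl

/-- The adjoint `L_T^* : X → L²(0,T;U)`. -/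
def inputMapAdj (S : C0Semigroup X) (B : U →L[ℝ] X) (T : ℝ) : X →L[ℝ] ControlSpace U T :=
  ContinuousLinearMap.adjoint (inputMap S B T)

/-- The control `u` steers the system from `y₀` to `y_f` in time `T`. -/
def Steers (S : C0Semigroup X) (B : U →L[ℝ] X) (T : ℝ) (y₀ yf : X) (u : ControlSpace U T) :
    Prop :=
  solution S B y₀ u T = yf

end System

/-! ## Convex analysis -/

section Convex

variable {H : Type*} [NormedAddCommGroup H] [InnerProductSpace ℝ H]

/-- The convex conjugate `f*(x) = sup_y (⟨x, y⟩ - f y)`. -/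
def conjugate (f : H → EReal) (x : H) : EReal :=
  ⨆ y : H, ((⟪x, y⟫ : ℝ) : EReal) - f y

/-- The subdifferential `∂f(x)`. -/
def subdifferential (f : H → EReal) (x : H) : Set H :=
  {p | ∀ y, f x + ((⟪p, y - x⟫ : ℝ) : EReal) ≤ f y}

/-- The support function `σ_C`. -/
def supportFun (C : Set H) (x : H) : EReal :=
  ⨆ y ∈ C, ((⟪x, y⟫ : ℝ) : EReal)

/-- The gauge function `j_C(x) = inf {α > 0 : x ∈ α C}`, with value `+∞` if there is no such
`α`. -/
def gaugeFun (C : Set H) (x : H) : ℝ≥0∞ :=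
  ⨅ (α : ℝ≥0) (_ : 0 < α ∧ x ∈ (α : ℝ) • C), (α : ℝ≥0∞)

/-- The cone `{λ p : p ∈ K, λ > 0}` generated by `K`. -/
def coneOf (K : Set H) : Set H :=
  {x | ∃ r : ℝ, 0 < r ∧ ∃ p ∈ K, x = r • p}

/-- The polar cone of `P`. -/
def polar (P : Set H) : Set H :=
  {y | ∀ x ∈ P, ⟪x, y⟫ ≤ 0}

/-- The singular normal vectors of `C`: those `v` for which the maximum defining `σ_C(v)` is
reached at several points of `C`. -/
def sing (C : Set H) : Set H :=
  {v | ∃ a ∈ C, ∃ b ∈ C, a ≠ b ∧ ((⟪v, a⟫ : ℝ) : EReal) = supportFun C v ∧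
    ((⟪v, b⟫ : ℝ) : EReal) = supportFun C v}

/-- The closed convex hull of `K` (the relaxed generating constraint set). -/
def relaxed (K : Set H) : Set H :=
  closure (convexHull ℝ K)

end Convex

/-! ## Extended real arithmetic -/

/-- The square root of a nonnegative extended real (`+∞` at `+∞`). -/
def sqrtE (b : EReal) : EReal :=
  ((b.toENNReal ^ (1 / 2 : ℝ) : ℝ≥0∞) : EReal)

/-- The quotient `a / b` for `b ∈ [0,+∞]`, with `0/0 = 0`, `a/0 = +∞` for `a > 0` and
`a/0 = -∞` for `a < 0`. -/
def quot (a : ℝ) (b : EReal) : EReal :=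
  if b = 0 then (if a = 0 then 0 else if 0 < a then ⊤ else ⊥) else (a : EReal) / b

/-! ## Costs, dual functional and conditions -/

section Problem

variable {X U : Type*} [NormedAddCommGroup X] [InnerProductSpace ℝ X] [CompleteSpace X]
  [NormedAddCommGroup U] [InnerProductSpace ℝ U] [CompleteSpace U]

/-- The cost `F(u) = ½ ∫₀ᵀ j_C(u(t))² dt`. -/
def cost (C : Set U) (T : ℝ) (u : ControlSpace U T) : ℝ≥0∞ :=
  (1 / 2) * ∫⁻ t in Ioo 0 T, gaugeFun C (u t) ^ 2

/-- The set `L²_C` of the controls of finite cost. -/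
def finiteCost (C : Set U) (T : ℝ) : Set (ControlSpace U T) :=
  {u | cost C T u < ⊤}

/-- `F*`, the convex conjugate of the cost on `L²(0,T;U)`. -/
def dualCost (C : Set U) (T : ℝ) : ControlSpace U T → EReal :=
  conjugate fun u => (cost C T u : EReal)

/-- `y_f` is exactly reachable from `y₀` in time `T` under the constraints `P`, with controls
in `𝒜`. -/
def ExactlyReachable (S : C0Semigroup X) (B : U →L[ℝ] X) (T : ℝ) (P : Set U)
    (𝒜 : Set (ControlSpace U T)) (y₀ yf : X) : Prop :=
  ∃ u ∈ 𝒜, (∀ᵐ t ∂volume.restrict (Ioo 0 T), u t ∈ P) ∧ Steers S B T y₀ yf u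

/-- `y_f - S_T y₀`. -/
def shiftedTarget (S : C0Semigroup X) (T : ℝ) (y₀ yf : X) : X :=
  yf - S.op T.toNNReal y₀

/-- `⟨y_f - S_T y₀, p_f⟩ ≤ c F*(L_T^* p_f)^{1/2}` for all `p_f`. -/
def DualBound (S : C0Semigroup X) (B : U →L[ℝ] X) (T : ℝ) (C : Set U) (y₀ yf : X) (c : ℝ) :
    Prop :=
  ∀ p : X, ((⟪shiftedTarget S T y₀ yf, p⟫ : ℝ) : EReal) ≤
    (c : EReal) * sqrtE (dualCost C T (inputMapAdj S B T p))

/-- The quotient `⟨y_f - S_T y₀, p_f⟩ / F*(L_T^* p_f)^{1/2}`. -/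
def dualQuot (S : C0Semigroup X) (B : U →L[ℝ] X) (T : ℝ) (C : Set U) (y₀ yf p : X) : EReal :=
  quot ⟪shiftedTarget S T y₀ yf, p⟫ (sqrtE (dualCost C T (inputMapAdj S B T p)))

/-- `c⋆`, the supremum of the quotients over the unit sphere. -/
def cStar (S : C0Semigroup X) (B : U →L[ℝ] X) (T : ℝ) (C : Set U) (y₀ yf : X) : EReal :=
  ⨆ p ∈ Metric.sphere (0 : X) 1, dualQuot S B T C y₀ yf p

/-- `c⋆` is attained. -/
def CStarAttained (S : C0Semigroup X) (B : U →L[ℝ] X) (T : ℝ) (C : Set U) (y₀ yf : X) : Prop :=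
  ∃ p ∈ Metric.sphere (0 : X) 1, dualQuot S B T C y₀ yf p = cStar S B T C y₀ yf

/-- The dual functional `J₀(p_f) = F*(L_T^* p_f) - ⟨y_f - S_T y₀, p_f⟩`. -/
def dualFunctional (S : C0Semigroup X) (B : U →L[ℝ] X) (T : ℝ) (C : Set U) (y₀ yf p : X) :
    EReal :=
  dualCost C T (inputMapAdj S B T p) - ((⟪shiftedTarget S T y₀ yf, p⟫ : ℝ) : EReal)

/-- `p` minimises `J₀` over `X`. -/
def IsDualMinimiser (S : C0Semigroup X) (B : U →L[ℝ] X) (T : ℝ) (C : Set U) (y₀ yf p : X) :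
    Prop :=
  IsMinOn (dualFunctional S B T C y₀ yf) univ p

/-- Condition (H) at `p`: for a.e. `t`, `L_T^* p (t)` is not in `sing(C) ∩ (cone(C)°)ᶜ`. -/
def CondH (S : C0Semigroup X) (B : U →L[ℝ] X) (T : ℝ) (C : Set U) (p : X) : Prop :=
  ∀ᵐ t ∂volume.restrict (Ioo 0 T), inputMapAdj S B T p t ∉ sing C ∩ (polar (coneOf C))ᶜ

end Problem

end ConicControl

end

open ConicControl

/-! Write `C` for the relaxed constraint set, `σ_K` for the support function of a set `K`, and let
`K = {F ≤ 1/2}` in `L²(0,T;U)`. Subadditivity of the gauge, Fatou's lemma and boundedness of `C`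
make `K` a bounded closed convex set containing the origin. Since `F` is homogeneous of degree two,
`F u ≤ s² / 2` means `u ∈ s K` (`cost_le_iff`). Hence `F* = σ_K² / 2`, and its subgradients at `q`
are the `u ∈ σ_K(q) K` with `⟪u, q⟫ = σ_K(q)²` (`mem_dualityMap_iff`).

Put `N p = F*(L_T^* p)^{1/2} = σ_K(L_T^* p) / √2`, which is nonnegative and positively homogeneous.
The set `L_T(s K)` is convex and closed, so by Hahn-Banach the shifted target `y` lies in it as soon
as `⟪y, ·⟫ ≤ s σ_K(L_T^* ·)` (`exists_mem_smul_map_eq`); this is the reachability criterion. On each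
ray `J₀ = N² - ⟪y, ·⟫` is a quadratic polynomial, and optimising it relates minimisers to maximisers
of the quotient. A minimiser `p` satisfies `⟪y, p⟫ = 2 N(p)²` and `⟪y, ·⟫ ≤ 2 N(p) N`, so separation
yields a steering control, which is then a subgradient.

Uniqueness is read off pointwise. A subgradient `u` of `F*` at `q` satisfies `u t ∈ ∂(σ_C² / 2)(q
t)` almost everywhere (`ae_mem_dualityMap`), and that set is a singleton exactly when `q t` avoids
the exceptional set of (H). The converse avoids measurable selections: subgradients at `q` perturbed
by a constant direction dominate every pointwise subgradient in that direction, and they approach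
`u` because `u` is the only subgradient at `q`. Under (E), a unique maximiser over `C` is an extreme
point, hence lies in `𝒰`. -/

namespace ConicControl

/-! ### Convex bodies, support functions and separation -/

section ConvexBodies

variable {H X : Type*} [NormedAddCommGroup H] [InnerProductSpace ℝ H]
  [NormedAddCommGroup X] [InnerProductSpace ℝ X]

/-- A decreasing sequence of nonempty bounded closed convex subsets of a Hilbert space has a common
point. -/
theorem nonempty_iInter_of_antitone_convex [CompleteSpace H] {V : ℕ → Set H} (hV : Antitone V)
    (hne : ∀ n, (V n).Nonempty) (hcl : ∀ n, IsClosed (V n)) (hcv : ∀ n, Convex ℝ (V n))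
    {M : ℝ} (hM : ∀ n, ∀ x ∈ V n, ‖x‖ ≤ M) : ∃ x, ∀ n, x ∈ V n := by
  -- Points of least norm replace weak compactness: their norms increase and are bounded, and the
  -- variational inequality turns this into a Cauchy property.
  have h1 : ∀ n, ∃ x ∈ V n, ∀ w ∈ V n, 0 ≤ ⟪x, w - x⟫ := by
    intro n
    obtain ⟨x, hx, hmin⟩ :=
      exists_norm_eq_iInf_of_complete_convex (hne n) (hcl n).isComplete (hcv n) 0
    refine ⟨x, hx, fun w hw => ?_⟩
    have := (norm_eq_iInf_iff_real_inner_le_zero (hcv n) hx).1 hmin w hw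
    rw [zero_sub, inner_neg_left] at this
    linarith
  choose x hx hmin using h1
  have h2 : ∀ n m, n ≤ m → ‖x m - x n‖ ^ 2 ≤ ‖x m‖ ^ 2 - ‖x n‖ ^ 2 := by
    intro n m hnm
    have h3 := hmin n (x m) (hV hnm (hx m))
    have h4 := norm_add_sq_real (x n) (x m - x n)
    rw [add_sub_cancel] at h4
    linarith
  have hmono : Monotone fun n => ‖x n‖ ^ 2 := fun n m hnm => by
    have := h2 n m hnm
    have := sq_nonneg ‖x m - x n‖
    change ‖x n‖ ^ 2 ≤ ‖x m‖ ^ 2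
    linarith
  have hbd : BddAbove (range fun n => ‖x n‖ ^ 2) := by
    refine ⟨M ^ 2, ?_⟩
    rintro _ ⟨n, rfl⟩
    exact pow_le_pow_left₀ (norm_nonneg _) (hM n _ (hx n)) 2
  have hca := (tendsto_atTop_ciSup hmono hbd).cauchySeq
  have hcx : CauchySeq x := by
    rw [Metric.cauchySeq_iff'] at hca ⊢
    intro ε hε
    obtain ⟨N, hN⟩ := hca (ε ^ 2) (by positivity)
    refine ⟨N, fun n hn => ?_⟩
    have h3 := h2 N n hn
    have h4 := hN n hn
    rw [Real.dist_eq] at h4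
    rw [dist_eq_norm]
    refine lt_of_pow_lt_pow_left₀ 2 hε.le ?_
    linarith [le_abs_self (‖x n‖ ^ 2 - ‖x N‖ ^ 2)]
  obtain ⟨y, hy⟩ := cauchySeq_tendsto_of_complete hcx
  refine ⟨y, fun n => (hcl n).mem_of_tendsto hy ?_⟩
  filter_upwards [eventually_ge_atTop n] with m hm using hV hm (hx m)

/-- Bounded closed convex sets containing the origin. -/
structure IsConvexBody (K : Set H) : Prop where
  isClosed : IsClosed K
  convex : Convex ℝ K
  isBounded : Bornology.IsBounded K
  zero_mem : (0 : H) ∈ K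

/-- The support function of a set, with real values. -/
noncomputable def supportReal (K : Set H) (q : H) : ℝ :=
  sSup ((fun w => ⟪q, w⟫) '' K)

/-- The subdifferential of half the squared support function of `K`: the vectors `u` of
`σ_K(q) K` such that `⟪u, q⟫ = σ_K(q)²`. -/
def dualityMap (K : Set H) (q : H) : Set H :=
  {u | u ∈ supportReal K q • K ∧ ⟪u, q⟫ = supportReal K q ^ 2}

namespace IsConvexBody

variable {K : Set H} (hK : IsConvexBody K)

include hK

theorem exists_norm_le : ∃ R : ℝ, 0 < R ∧ ∀ x ∈ K, ‖x‖ ≤ R :=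
  hK.isBounded.exists_pos_norm_le

theorem smul_subset_smul {a b : ℝ} (ha : 0 ≤ a) (hab : a ≤ b) : a • K ⊆ b • K := by
  rcases ha.eq_or_lt with rfl | ha
  · rw [zero_smul_set ⟨0, hK.zero_mem⟩]
    rintro _ rfl
    exact ⟨0, hK.zero_mem, smul_zero _⟩
  · rintro _ ⟨x, hx, rfl⟩
    have hb : 0 < b := ha.trans_le hab
    refine ⟨(a / b) • x, hK.convex.smul_mem_of_zero_mem hK.zero_mem hx
      ⟨by positivity, (div_le_one hb).2 hab⟩, ?_⟩
    change b • (a / b) • x = a • x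
    rw [smul_smul, mul_div_cancel₀ _ hb.ne']

theorem smul {a : ℝ} : IsConvexBody (a • K) where
  isClosed := by
    rcases eq_or_ne a 0 with rfl | ha
    · rw [zero_smul_set ⟨0, hK.zero_mem⟩]
      exact isClosed_singleton
    · exact hK.isClosed.smul_of_ne_zero ha
  convex := hK.convex.smul a
  isBounded := hK.isBounded.smul₀ a
  zero_mem := ⟨0, hK.zero_mem, smul_zero _⟩

theorem bddAbove (q : H) : BddAbove ((fun w => ⟪q, w⟫) '' K) := by
  obtain ⟨R, -, hR⟩ := hK.exists_norm_le
  refine ⟨‖q‖ * R, ?_⟩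
  rintro _ ⟨w, hw, rfl⟩
  exact (real_inner_le_norm q w).trans (by gcongr; exact hR w hw)

theorem inner_le (q : H) {w : H} (hw : w ∈ K) : ⟪q, w⟫ ≤ supportReal K q :=
  le_csSup (hK.bddAbove q) ⟨w, hw, rfl⟩

theorem supportReal_nonneg (q : H) : 0 ≤ supportReal K q := by
  simpa using hK.inner_le q hK.zero_mem

theorem inner_le_of_mem_smul (q : H) {w : H} {a : ℝ} (ha : 0 ≤ a) (hw : w ∈ a • K) :
    ⟪q, w⟫ ≤ a * supportReal K q := by
  obtain ⟨x, hx, rfl⟩ := hw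
  change ⟪q, a • x⟫ ≤ _
  rw [inner_smul_right]
  exact mul_le_mul_of_nonneg_left (hK.inner_le q hx) ha

theorem supportReal_le {q : H} {M : ℝ} (h : ∀ w ∈ K, ⟪q, w⟫ ≤ M) : supportReal K q ≤ M := by
  refine csSup_le ⟨_, 0, hK.zero_mem, rfl⟩ ?_
  rintro _ ⟨w, hw, rfl⟩
  exact h w hw

theorem supportReal_smul (q : H) {a : ℝ} (ha : 0 ≤ a) :
    supportReal K (a • q) = a * supportReal K q := by
  have key : ∀ (p : H) {b : ℝ}, 0 ≤ b → supportReal K (b • p) ≤ b * supportReal K p := by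
    intro p b hb
    refine hK.supportReal_le fun w hw => ?_
    rw [real_inner_smul_left]
    exact mul_le_mul_of_nonneg_left (hK.inner_le p hw) hb
  refine le_antisymm (key q ha) ?_
  rcases ha.eq_or_lt with rfl | ha
  · simpa using hK.supportReal_nonneg _
  · have := key (a • q) (inv_nonneg.2 ha.le)
    rw [smul_smul, inv_mul_cancel₀ ha.ne', one_smul, ← div_eq_inv_mul, le_div_iff₀ ha] at this
    linarith

theorem supportReal_add_le (q p : H) :
    supportReal K (q + p) ≤ supportReal K q + supportReal K p := by
  refine hK.supportReal_le fun w hw => ?_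
  rw [inner_add_left]
  exact add_le_add (hK.inner_le q hw) (hK.inner_le p hw)

theorem supportReal_le_norm {R : ℝ} (hR : ∀ x ∈ K, ‖x‖ ≤ R) (q : H) :
    supportReal K q ≤ R * ‖q‖ :=
  hK.supportReal_le fun w hw => (real_inner_le_norm q w).trans (by
    rw [mul_comm]; gcongr; exact hR w hw)

/-- The supremum defining the support function is reached. -/
theorem exists_inner_eq [CompleteSpace H] (q : H) : ∃ w ∈ K, ⟪q, w⟫ = supportReal K q := by
  obtain ⟨R, -, hR⟩ := hK.exists_norm_le
  obtain ⟨w, hw⟩ := nonempty_iInter_of_antitone_convex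
    (V := fun n : ℕ => K ∩ {w | supportReal K q - 1 / (n + 1) ≤ ⟪q, w⟫}) (M := R) (by
      intro n m hnm w hw
      refine ⟨hw.1, (le_trans ?_ hw.2 : supportReal K q - 1 / (n + 1) ≤ ⟪q, w⟫)⟩
      have := Nat.one_div_le_one_div (α := ℝ) hnm
      linarith) (by
      intro n
      obtain ⟨_, ⟨w, hw, rfl⟩, h⟩ := exists_lt_of_lt_csSup (s := (fun w => ⟪q, w⟫) '' K)
        ⟨_, 0, hK.zero_mem, rfl⟩
        (show supportReal K q - 1 / (n + 1) < sSup ((fun w => ⟪q, w⟫) '' K) from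
          sub_lt_self _ (by positivity))
      exact ⟨w, hw, h.le⟩)
    (fun n => hK.isClosed.inter (isClosed_le continuous_const (by fun_prop)))
    (fun n => hK.convex.inter (convex_halfSpace_ge (innerₛₗ ℝ q).isLinear _))
    (fun n x hx => hR x hx.1)
  refine ⟨w, (hw 0).1, le_antisymm (hK.inner_le q (hw 0).1) ?_⟩
  have h1 : Tendsto (fun n : ℕ => supportReal K q - 1 / ((n : ℝ) + 1)) atTop
      (𝓝 (supportReal K q - 0)) :=
    tendsto_const_nhds.sub tendsto_one_div_add_atTop_nhds_zero_nat
  rw [sub_zero] at h1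
  exact le_of_tendsto' h1 fun n => (hw n).2

/-- The image of a convex body under a bounded operator is closed. -/
theorem isClosed_image [CompleteSpace H] (L : H →L[ℝ] X) : IsClosed (L '' K) := by
  obtain ⟨R, -, hR⟩ := hK.exists_norm_le
  refine isClosed_of_closure_subset fun y hy => ?_
  obtain ⟨w, hw⟩ := nonempty_iInter_of_antitone_convex
    (V := fun n : ℕ => K ∩ L ⁻¹' Metric.closedBall y (1 / (n + 1))) (M := R) (by
      intro n m hnm w hw
      exact ⟨hw.1, Metric.closedBall_subset_closedBall (Nat.one_div_le_one_div hnm) hw.2⟩) (by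
      intro n
      obtain ⟨_, ⟨w, hw, rfl⟩, h⟩ := Metric.mem_closure_iff.1 hy (1 / ((n : ℝ) + 1)) (by positivity)
      exact ⟨w, hw, by simpa [dist_comm] using h.le⟩)
    (fun n => hK.isClosed.inter (Metric.isClosed_closedBall.preimage L.continuous))
    (fun n => hK.convex.inter ((convex_closedBall y _).linear_preimage (L : H →ₗ[ℝ] X)))
    (fun n x hx => hR x hx.1)
  refine ⟨w, (hw 0).1, ?_⟩
  rw [← dist_le_zero]
  exact ge_of_tendsto' (tendsto_one_div_add_atTop_nhds_zero_nat (𝕜 := ℝ)) fun n => (hw n).2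

/-- A vector whose inner products are dominated by the support function of `L (s K)` belongs to
`L (s K)`. -/
theorem exists_mem_smul_map_eq [CompleteSpace H] [CompleteSpace X] (L : H →L[ℝ] X) {s : ℝ}
    {y : X}
    (h : ∀ p, ⟪y, p⟫ ≤ s * supportReal K (ContinuousLinearMap.adjoint L p)) :
    ∃ u ∈ s • K, L u = y := by
  by_contra hy
  have hsK : IsConvexBody (s • K) := hK.smul
  -- The separating functional is below `c` at `L (s • w)`, where `w` maximises over `K`; there it
  -- equals `s σ_K(L* p)`, which by hypothesis bounds its value at `y`.
  obtain ⟨f, c, hf, hc⟩ := geometric_hahn_banach_closed_point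
    (hsK.convex.linear_image (L : H →ₗ[ℝ] X)) (hsK.isClosed_image L) (x := y) hy
  set p := (InnerProductSpace.toDual ℝ X).symm f with hp
  have hfp : ∀ x, f x = ⟪p, x⟫ := fun x => by rw [hp, InnerProductSpace.toDual_symm_apply]
  obtain ⟨w, hw, hwp⟩ := hK.exists_inner_eq (ContinuousLinearMap.adjoint L p)
  have h1 := hf _ ⟨s • w, ⟨w, hw, rfl⟩, rfl⟩
  have h2 : f (L (s • w)) = s * supportReal K (ContinuousLinearMap.adjoint L p) := by
    rw [hfp, ← hwp, ContinuousLinearMap.adjoint_inner_left, map_smul, inner_smul_right]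
  have h3 := h p
  rw [real_inner_comm, ← hfp] at h3
  have h4 : f (L (s • w)) < c := h1
  linarith

/-- Separation for the identity map. It lets membership in a dilate of `K` pass to limits, since
only scalar inequalities are involved. -/
theorem mem_smul_of_inner_le [CompleteSpace H] {s : ℝ} {u : H}
    (h : ∀ p, ⟪u, p⟫ ≤ s * supportReal K p) : u ∈ s • K := by
  obtain ⟨v, hv, rfl⟩ := hK.exists_mem_smul_map_eq (ContinuousLinearMap.id ℝ H) (y := u)
    (by simpa [ContinuousLinearMap.adjoint_id] using h)
  exact hv

theorem dualityMap_nonempty [CompleteSpace H] (q : H) : (dualityMap K q).Nonempty := by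
  obtain ⟨w, hw, h⟩ := hK.exists_inner_eq q
  refine ⟨supportReal K q • w, ⟨w, hw, rfl⟩, ?_⟩
  rw [real_inner_smul_left, real_inner_comm, h, sq]

theorem inner_le_of_mem_dualityMap {q u : H} (hu : u ∈ dualityMap K q) (p : H) :
    ⟪u, p⟫ ≤ supportReal K q * supportReal K p := by
  rw [real_inner_comm]
  exact hK.inner_le_of_mem_smul p (hK.supportReal_nonneg q) hu.1

/-- `dualityMap K` is the subdifferential of `½ σ_K²`. -/
theorem mem_dualityMap_iff [CompleteSpace H] {q u : H} :
    u ∈ dualityMap K q ↔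
      ∀ p, supportReal K q ^ 2 / 2 + ⟪u, p - q⟫ ≤ supportReal K p ^ 2 / 2 := by
  constructor
  · intro hu p
    have h1 := hK.inner_le_of_mem_dualityMap hu p
    rw [inner_sub_right, hu.2]
    nlinarith [sq_nonneg (supportReal K q - supportReal K p)]
  · intro h
    set s := supportReal K q with hs
    have hs0 : 0 ≤ s := hK.supportReal_nonneg q
    -- Both properties of `u` come from testing the subgradient inequality along rays.
    have hscale : ∀ (p : H) (a : ℝ), 0 ≤ a →
        s ^ 2 / 2 + a * ⟪u, p⟫ - ⟪u, q⟫ ≤ a ^ 2 * supportReal K p ^ 2 / 2 := by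
      intro p a ha
      have := h (a • p)
      rw [hK.supportReal_smul p ha, inner_sub_right, inner_smul_right] at this
      nlinarith
    have hq : ⟪u, q⟫ = s ^ 2 := by
      set d := ⟪u, q⟫ - s ^ 2 with hd
      have h1 : ∀ ε : ℝ, 0 ≤ 1 + ε → ε * d ≤ ε ^ 2 * s ^ 2 / 2 := by
        intro ε hε
        have := hscale q (1 + ε) hε
        rw [← hs] at this
        nlinarith
      -- The increment `e = ε d` will be tested; `ε` is small enough that `|ε d| ≤ 1` and `ε s² ≤
      -- 1`, so the linear term `2 ε d²` beats the quadratic one.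
      have hε : 0 < 1 / (1 + s ^ 2 + |d|) := by positivity
      set ε := 1 / (1 + s ^ 2 + |d|) with hεd
      have hm : ε * (1 + s ^ 2 + |d|) = 1 := by rw [hεd]; field_simp
      have hε1 : ε ≤ 1 := by nlinarith [sq_nonneg s, abs_nonneg d]
      have hb : ∀ e : ℝ, |e| ≤ 1 → 2 * (e * d) ≤ e ^ 2 * s ^ 2 := fun e he => by
        have := h1 e (by linarith [neg_abs_le e])
        linarith
      by_contra hne
      have hd0 : d ≠ 0 := by rw [hd]; exact sub_ne_zero.2 hne
      have h3 := hb (ε * d) (by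
        rw [abs_mul, abs_of_pos hε]
        nlinarith [sq_nonneg s, abs_nonneg d])
      have h4 : 0 < ε * d ^ 2 := by positivity
      have h5 : ε * s ^ 2 ≤ 1 := by nlinarith [abs_nonneg d]
      nlinarith
    refine ⟨hK.mem_smul_of_inner_le (s := s) fun p => ?_, hq⟩
    have hp0 := hK.supportReal_nonneg p
    set r := supportReal K p
    have h1 : ∀ a : ℝ, 0 ≤ a → a * ⟪u, p⟫ ≤ a ^ 2 * r ^ 2 / 2 + s ^ 2 / 2 := by
      intro a ha
      have := hscale p a ha
      rw [hq] at this
      linarith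
    by_contra! hlt
    -- The factor `a = s / r` is the optimal one and gives `⟪u, p⟫ ≤ s r`; the cases `r = 0` and `s
    -- = 0` need their own factors.
    rcases hp0.eq_or_lt with h0 | h0
    · rw [← h0, mul_zero] at hlt
      have := h1 ((s ^ 2 / 2 + 1) / ⟪u, p⟫) (by positivity)
      rw [← h0, div_mul_cancel₀ _ hlt.ne'] at this
      norm_num at this
    · rcases hs0.eq_or_lt with h00 | h00
      · rw [← h00, zero_mul] at hlt
        have := h1 (⟪u, p⟫ / r ^ 2) (by positivity)
        have h6 : (⟪u, p⟫ / r ^ 2) ^ 2 * r ^ 2 = ⟪u, p⟫ / r ^ 2 * ⟪u, p⟫ := by field_simp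
        have h7 : 0 < ⟪u, p⟫ / r ^ 2 * ⟪u, p⟫ := by positivity
        rw [h6, ← h00] at this
        linarith
      · have := h1 (s / r) (by positivity)
        have h6 : (s / r) ^ 2 * r ^ 2 = s ^ 2 := by field_simp
        have h7 : s / r * (s * r) < s / r * ⟪u, p⟫ := by gcongr
        have h8 : s / r * (s * r) = s ^ 2 := by field_simp
        rw [h6] at this
        linarith

/-- Monotonicity of a subdifferential: each cross term is at most `σ_K(q) σ_K(p)`, which leaves at
least `(σ_K(q) - σ_K(p))²`. -/
theorem inner_sub_sub_nonneg {q p u v : H} (hu : u ∈ dualityMap K q) (hv : v ∈ dualityMap K p) :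
    0 ≤ ⟪u - v, q - p⟫ := by
  have h1 := hK.inner_le_of_mem_dualityMap hu p
  have h2 := hK.inner_le_of_mem_dualityMap hv q
  rw [inner_sub_left, inner_sub_right, inner_sub_right, hu.2, hv.2]
  nlinarith [sq_nonneg (supportReal K q - supportReal K p)]

end IsConvexBody

end ConvexBodies

/-! ### Directional derivatives, conjugates and gauges -/

namespace IsConvexBody

variable {H : Type*} [NormedAddCommGroup H] [InnerProductSpace ℝ H] [CompleteSpace H]
  {K : Set H} (hK : IsConvexBody K)

include hK

/-- Directional derivatives of `½ σ_K²` at a point with a unique subgradient `u` are given by `u`: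
along subgradients at `q + h / (k + 1)`, the products with `h` come arbitrarily close to `⟪u, h⟫`. -/
theorem exists_inner_sub_lt {q u : H} (hu : dualityMap K q = {u}) (h : H) {v : ℕ → H}
    (hv : ∀ k : ℕ, v k ∈ dualityMap K (q + (1 / ((k : ℝ) + 1)) • h)) {ε : ℝ} (hε : 0 < ε) :
    ∃ k, ⟪v k - u, h⟫ < ε := by
  by_contra! hcon
  obtain ⟨R, hR0, hR⟩ := hK.exists_norm_le
  have huq : u ∈ dualityMap K q := hu ▸ mem_singleton u
  have hr0 : ∀ k : ℕ, 0 < 1 / ((k : ℝ) + 1) := fun k => by positivity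
  have hr1 : ∀ k : ℕ, 1 / ((k : ℝ) + 1) ≤ 1 := fun k => by
    rw [div_le_one (by positivity)]
    linarith [(k.cast_nonneg : (0 : ℝ) ≤ k)]
  set M := R * (‖q‖ + ‖h‖) * R with hM
  have hvM : ∀ k, ‖v k‖ ≤ M := by
    intro k
    obtain ⟨w, hw, hwv⟩ := (hv k).1
    rw [← hwv]
    change ‖_ • w‖ ≤ M
    rw [norm_smul, Real.norm_eq_abs, abs_of_nonneg (hK.supportReal_nonneg _)]
    have h1 := hK.supportReal_le_norm hR (q + (1 / ((k : ℝ) + 1)) • h)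
    have h2 : ‖q + (1 / ((k : ℝ) + 1)) • h‖ ≤ ‖q‖ + ‖h‖ := by
      refine (norm_add_le _ _).trans ?_
      rw [norm_smul, Real.norm_eq_abs, abs_of_pos (hr0 k)]
      have := mul_le_mul_of_nonneg_right (hr1 k) (norm_nonneg h)
      linarith
    have h3 := hR w hw
    calc _ ≤ (R * ‖q + (1 / ((k : ℝ) + 1)) • h‖) * R := by gcongr
      _ ≤ _ := by rw [hM]; gcongr
  set D := (M + ‖u‖) * ‖h‖ with hD
  have hM0 : 0 ≤ M := (norm_nonneg _).trans (hvM 0)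
  have hD0 : 0 ≤ D := by positivity
  -- The `k`-th set holds the subgradients at `q` up to an error `D / (k + 1)` whose product with
  -- `h` exceeds that of `u` by at least `ε`. A common point is an exact subgradient at `q` other
  -- than `u`, which is impossible.
  obtain ⟨x, hx⟩ := nonempty_iInter_of_antitone_convex (M := M)
    (V := fun k : ℕ => (Metric.closedBall 0 M ∩ {w | ε + ⟪h, u⟫ ≤ ⟪h, w⟫}) ∩
      ⋂ p, {w | ⟪p - q, w⟫ ≤ supportReal K p ^ 2 / 2 - supportReal K q ^ 2 / 2 +
        1 / ((k : ℝ) + 1) * D})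
    (by
      intro n m hnm w hw
      refine ⟨hw.1, mem_iInter.2 fun p => ?_⟩
      have h1 : ⟪p - q, w⟫ ≤ _ := mem_iInter.1 hw.2 p
      refine h1.trans ?_
      have := Nat.one_div_le_one_div (α := ℝ) hnm
      gcongr)
    (by
      intro k
      refine ⟨v k, ⟨by simpa using hvM k, ?_⟩, mem_iInter.2 fun p => ?_⟩
      · have := hcon k
        rw [inner_sub_left] at this
        rw [mem_ofPred_eq, real_inner_comm h (v k), real_inner_comm h u] at *
        linarith
      · have h1 := hK.mem_dualityMap_iff.1 (hv k) p
        have h2 := hK.mem_dualityMap_iff.1 huq (q + (1 / ((k : ℝ) + 1)) • h)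
        rw [add_sub_cancel_left, inner_smul_right] at h2
        rw [← sub_sub, inner_sub_right, inner_smul_right] at h1
        have h3 : ⟪v k, h⟫ - ⟪u, h⟫ ≤ D := by
          rw [← inner_sub_left]
          refine (real_inner_le_norm _ _).trans ?_
          rw [hD]
          gcongr
          exact (norm_sub_le _ _).trans (by gcongr; exact hvM k)
        have h4 := mul_le_mul_of_nonneg_left h3 (hr0 k).le
        rw [mem_ofPred_eq, real_inner_comm]
        linarith)
    (fun k => (Metric.isClosed_closedBall.inter
      (isClosed_le continuous_const (by fun_prop))).inter
      (isClosed_iInter fun p => isClosed_le (by fun_prop) continuous_const))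
    (fun k => ((convex_closedBall 0 M).inter
      (convex_halfSpace_ge (innerₛₗ ℝ h).isLinear _)).inter
      (convex_iInter fun p => convex_halfSpace_le (innerₛₗ ℝ (p - q)).isLinear _))
    (fun k w hw => by simpa using hw.1.1)
  have hxq : x ∈ dualityMap K q := by
    refine hK.mem_dualityMap_iff.2 fun p => ?_
    have h1 : Tendsto (fun k : ℕ => supportReal K p ^ 2 / 2 - supportReal K q ^ 2 / 2 +
        1 / ((k : ℝ) + 1) * D) atTop
        (𝓝 (supportReal K p ^ 2 / 2 - supportReal K q ^ 2 / 2 + 0 * D)) :=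
      tendsto_const_nhds.add (tendsto_one_div_add_atTop_nhds_zero_nat.mul_const D)
    have h2 := ge_of_tendsto' h1 fun k => mem_iInter.1 (hx k).2 p
    rw [real_inner_comm] at h2
    linarith
  have hxu : x = u := by
    rw [hu] at hxq
    exact hxq
  have h5 : ε + ⟪h, u⟫ ≤ ⟪h, x⟫ := (hx 0).1.2
  rw [hxu] at h5
  linarith

section Conjugate

variable {φ : H → ℝ≥0∞}
  (hφ : ∀ s : ℝ, 0 ≤ s → ∀ u, φ u ≤ ENNReal.ofReal (s ^ 2 / 2) ↔ u ∈ s • K)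

include hφ

/-- The conjugate of half the squared gauge is half the squared support function. -/
theorem conjugate_eq (q : H) :
    conjugate (fun u => (φ u : EReal)) q = ((supportReal K q ^ 2 / 2 : ℝ) : EReal) := by
  refine le_antisymm (iSup_le fun y => ?_) ?_
  · rcases eq_or_ne (φ y) ⊤ with hy | hy
    · simp [hy]
    · set t := (φ y).toReal
      have ht0 : 0 ≤ t := ENNReal.toReal_nonneg
      have hyt : φ y = ENNReal.ofReal t := (ENNReal.ofReal_toReal hy).symm
      -- `√(2 * t)` is the dilation factor `s` with `s² / 2 = φ y`; Young's inequality concludes.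
      have hs : √(2 * t) ^ 2 = 2 * t := Real.sq_sqrt (by positivity)
      have h1 : y ∈ √(2 * t) • K := by
        rw [← hφ _ (Real.sqrt_nonneg _), hs, hyt]
        exact ENNReal.ofReal_le_ofReal (by linarith)
      have h2 := hK.inner_le_of_mem_smul q (Real.sqrt_nonneg _) h1
      change _ - (φ y : EReal) ≤ _
      rw [hyt, EReal.coe_ennreal_ofReal, max_eq_left ht0, ← EReal.coe_sub, EReal.coe_le_coe_iff]
      nlinarith [sq_nonneg (√(2 * t) - supportReal K q)]
  -- Any element of `dualityMap K q` reaches the bound.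
  · obtain ⟨u, hu⟩ := hK.dualityMap_nonempty q
    refine le_iSup_of_le u ?_
    have h1 := (hφ _ (hK.supportReal_nonneg q) u).2 hu.1
    have h2 : (φ u : EReal) ≤ ((supportReal K q ^ 2 / 2 : ℝ) : EReal) := by
      have := EReal.coe_ennreal_le_coe_ennreal_iff.2 h1
      rwa [EReal.coe_ennreal_ofReal, max_eq_left (by positivity)] at this
    refine le_trans ?_ (EReal.sub_le_sub le_rfl h2)
    rw [real_inner_comm, hu.2, ← EReal.coe_sub, EReal.coe_le_coe_iff]
    linarith

theorem subdifferential_conjugate (q : H) :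
    subdifferential (conjugate fun u => (φ u : EReal)) q = dualityMap K q := by
  ext u
  rw [hK.mem_dualityMap_iff]
  simp only [subdifferential, mem_ofPred_eq, hK.conjugate_eq hφ, ← EReal.coe_add,
    EReal.coe_le_coe_iff]

end Conjugate

/-! ### Gauge functions -/

/-- The infimum is reached: `x` lies in every larger dilate, and the support inequalities pass to
the limit. This covers `a = 0`, which the definition excludes and where the dilate is `{0}`. -/
theorem gaugeFun_le_coe_iff {x : H} {a : ℝ≥0} : gaugeFun K x ≤ a ↔ x ∈ (a : ℝ) • K := by
  constructor
  · intro h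
    have h1 : ∀ n : ℕ, x ∈ ((a : ℝ) + 1 / (n + 1)) • K := by
      intro n
      have h2 : gaugeFun K x < ((a + 1 / (n + 1) : ℝ≥0) : ℝ≥0∞) := by
        refine h.trans_lt ?_
        rw [ENNReal.coe_lt_coe]
        exact lt_add_of_pos_right _ (by positivity)
      rw [gaugeFun] at h2
      obtain ⟨b, h2⟩ := iInf_lt_iff.1 h2
      obtain ⟨hb, h2⟩ := iInf_lt_iff.1 h2
      refine hK.smul_subset_smul b.2 ?_ hb.2
      have := (ENNReal.coe_lt_coe.1 h2).le
      exact_mod_cast this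
    refine hK.mem_smul_of_inner_le fun p => ?_
    have h3 : Tendsto (fun n : ℕ => ((a : ℝ) + 1 / (n + 1)) * supportReal K p) atTop
        (𝓝 (((a : ℝ) + 0) * supportReal K p)) :=
      (tendsto_const_nhds.add tendsto_one_div_add_atTop_nhds_zero_nat).mul_const _
    rw [add_zero] at h3
    refine ge_of_tendsto' h3 fun n => ?_
    rw [real_inner_comm]
    exact hK.inner_le_of_mem_smul p (by positivity) (h1 n)
  · intro h
    refine ENNReal.le_of_forall_pos_le_add fun ε hε _ => ?_
    rw [← ENNReal.coe_add]
    refine iInf₂_le (a + ε) ⟨by positivity, ?_⟩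
    exact hK.smul_subset_smul a.2 (by simp) h

theorem gaugeFun_toReal_mem {x : H} (hx : gaugeFun K x ≠ ⊤) :
    x ∈ (gaugeFun K x).toReal • K := by
  have := (hK.gaugeFun_le_coe_iff (x := x) (a := (gaugeFun K x).toNNReal)).1
    (by rw [ENNReal.coe_toNNReal hx])
  exact this

theorem gaugeFun_smul {a : ℝ≥0} (ha : 0 < a) (x : H) :
    gaugeFun K ((a : ℝ) • x) = a * gaugeFun K x := by
  have key : ∀ {b : ℝ≥0} (x : H), gaugeFun K ((b : ℝ) • x) ≤ b * gaugeFun K x ∨ b = 0 := by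
    intro b x
    rcases eq_or_ne b 0 with hb | hb
    · exact Or.inr hb
    left
    rcases eq_or_ne (gaugeFun K x) ⊤ with h | h
    · rw [h, ENNReal.mul_top (by simpa using hb)]
      exact le_top
    · obtain ⟨c, hc⟩ : ∃ c : ℝ≥0, (c : ℝ≥0∞) = gaugeFun K x :=
      ⟨_, ENNReal.coe_toNNReal h⟩
      rw [← hc, ← ENNReal.coe_mul, hK.gaugeFun_le_coe_iff, NNReal.coe_mul, mul_smul]
      exact smul_mem_smul_set (hK.gaugeFun_le_coe_iff.1 hc.symm.le)
  refine le_antisymm ((key x).resolve_right ha.ne') ?_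
  have h1 := (key (b := a⁻¹) ((a : ℝ) • x)).resolve_right (inv_ne_zero ha.ne')
  rw [NNReal.coe_inv, smul_smul, inv_mul_cancel₀ (by simpa using ha.ne'), one_smul] at h1
  calc (a : ℝ≥0∞) * gaugeFun K x ≤ a * ((a⁻¹ : ℝ≥0) * gaugeFun K ((a : ℝ) • x)) := by gcongr
    _ = _ := by
      rw [← mul_assoc, ← ENNReal.coe_mul, mul_inv_cancel₀ ha.ne', ENNReal.coe_one, one_mul]

theorem gaugeFun_add_le (x y : H) : gaugeFun K (x + y) ≤ gaugeFun K x + gaugeFun K y := by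
  rcases eq_or_ne (gaugeFun K x) ⊤ with h | hx
  · simp [h]
  rcases eq_or_ne (gaugeFun K y) ⊤ with h | hy
  · simp [h]
  obtain ⟨a, ha⟩ : ∃ a : ℝ≥0, (a : ℝ≥0∞) = gaugeFun K x :=
      ⟨_, ENNReal.coe_toNNReal hx⟩
  obtain ⟨b, hb⟩ : ∃ b : ℝ≥0, (b : ℝ≥0∞) = gaugeFun K y :=
      ⟨_, ENNReal.coe_toNNReal hy⟩
  rw [← ha, ← hb, ← ENNReal.coe_add, hK.gaugeFun_le_coe_iff, NNReal.coe_add,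
    hK.convex.add_smul a.coe_nonneg b.coe_nonneg]
  exact add_mem_add (hK.gaugeFun_le_coe_iff.1 ha.symm.le) (hK.gaugeFun_le_coe_iff.1 hb.symm.le)

theorem lowerSemicontinuous_gaugeFun : LowerSemicontinuous (gaugeFun K) := by
  rw [lowerSemicontinuous_iff_isClosed_preimage]
  intro a
  rcases eq_or_ne a ⊤ with rfl | ha
  · simp
  · lift a to ℝ≥0 using ha
    have : gaugeFun K ⁻¹' Iic (a : ℝ≥0∞) = (a : ℝ) • K := by
      ext x
      exact hK.gaugeFun_le_coe_iff
    rw [this]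
    exact hK.smul.isClosed

theorem enorm_le_gaugeFun {R : ℝ≥0} (hR0 : R ≠ 0) (hR : ∀ x ∈ K, ‖x‖ ≤ R) (x : H) :
    ‖x‖ₑ ≤ R * gaugeFun K x := by
  rcases eq_or_ne (gaugeFun K x) ⊤ with h | h
  · rw [h, ENNReal.mul_top (by simpa using hR0)]
    exact le_top
  · obtain ⟨a, ha⟩ : ∃ a : ℝ≥0, (a : ℝ≥0∞) = gaugeFun K x :=
      ⟨_, ENNReal.coe_toNNReal h⟩
    obtain ⟨w, hw, rfl⟩ := hK.gaugeFun_le_coe_iff.1 ha.symm.le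
    rw [← ha, ← ENNReal.coe_mul, enorm_le_coe, ← NNReal.coe_le_coe, coe_nnnorm]
    change ‖(a : ℝ) • w‖ ≤ _
    rw [norm_smul, NNReal.coe_mul, mul_comm]
    simp only [NNReal.norm_eq]
    gcongr
    exact hR w hw

theorem mem_coneOf_of_gaugeFun_ne_top {x : H} (hx : gaugeFun K x ≠ ⊤) : x ∈ coneOf K := by
  obtain ⟨w, hw, h⟩ := hK.gaugeFun_toReal_mem hx
  rcases (ENNReal.toReal_nonneg (a := gaugeFun K x)).eq_or_lt with h0 | h0
  · refine ⟨1, one_pos, 0, hK.zero_mem, ?_⟩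
    rw [← h]
    change _ • w = _
    rw [← h0, zero_smul, smul_zero]
  · exact ⟨_, h0, w, hw, h.symm⟩

end IsConvexBody

/-! ### The cost as half the squared gauge of a convex body of controls -/

/-- The controls of cost at most `1 / 2`. -/
def costBody {U : Type*} [NormedAddCommGroup U] [InnerProductSpace ℝ U] [CompleteSpace U]
    (C : Set U) (T : ℝ) : Set (ControlSpace U T) :=
  {u | cost C T u ≤ 1 / 2}

namespace IsConvexBody

variable {U : Type*} [NormedAddCommGroup U] [InnerProductSpace ℝ U] [CompleteSpace U]
  {C : Set U} (hC : IsConvexBody C) {T : ℝ}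

include hC

theorem measurable_gaugeFun_comp (u : ControlSpace U T) :
    Measurable fun t => gaugeFun C (u t) := by
  borelize U
  exact hC.lowerSemicontinuous_gaugeFun.measurable.comp (Lp.stronglyMeasurable u).measurable

theorem cost_smul {a : ℝ≥0} (ha : 0 < a) (u : ControlSpace U T) :
    cost C T ((a : ℝ) • u) = (a : ℝ≥0∞) ^ 2 * cost C T u := by
  have h1 : ∫⁻ t in Ioo 0 T, gaugeFun C (((a : ℝ) • u : ControlSpace U T) t) ^ 2 =
      ∫⁻ t in Ioo 0 T, (a : ℝ≥0∞) ^ 2 * gaugeFun C (u t) ^ 2 := by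
    refine lintegral_congr_ae ?_
    filter_upwards [Lp.coeFn_smul (a : ℝ) u] with t ht
    rw [ht, Pi.smul_apply, hC.gaugeFun_smul ha, mul_pow]
  rw [cost, h1, lintegral_const_mul _ ((hC.measurable_gaugeFun_comp u).pow_const 2), cost]
  ring

theorem cost_convex_comb_le (u v : ControlSpace U T) {a b : ℝ≥0} (ha : 0 < a) (hb : 0 < b)
    (hab : a + b = 1) :
    cost C T ((a : ℝ) • u + (b : ℝ) • v) ≤ a * cost C T u + b * cost C T v := by
  have h1 : ∫⁻ t in Ioo 0 T,
      gaugeFun C (((a : ℝ) • u + (b : ℝ) • v : ControlSpace U T) t) ^ 2 ≤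
      ∫⁻ t in Ioo 0 T, (a * gaugeFun C (u t) ^ 2 + b * gaugeFun C (v t) ^ 2) := by
    refine lintegral_mono_ae ?_
    filter_upwards [Lp.coeFn_smul (a : ℝ) u, Lp.coeFn_smul (b : ℝ) v,
      Lp.coeFn_add ((a : ℝ) • u) ((b : ℝ) • v)] with t h1 h2 h3
    rw [h3, Pi.add_apply, h1, h2, Pi.smul_apply, Pi.smul_apply]
    have h4 := hC.gaugeFun_add_le ((a : ℝ) • u t) ((b : ℝ) • v t)
    rw [hC.gaugeFun_smul ha, hC.gaugeFun_smul hb] at h4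
    have h5 := ENNReal.rpow_arith_mean_le_arith_mean2_rpow a b (gaugeFun C (u t))
      (gaugeFun C (v t)) (by exact_mod_cast hab) one_le_two
    simp only [ENNReal.rpow_two] at h5
    exact (pow_le_pow_left' h4 2).trans h5
  rw [lintegral_add_left (((hC.measurable_gaugeFun_comp u).pow_const 2).const_mul _),
    lintegral_const_mul _ ((hC.measurable_gaugeFun_comp u).pow_const 2),
    lintegral_const_mul _ ((hC.measurable_gaugeFun_comp v).pow_const 2)] at h1
  calc _ ≤ _ := mul_le_mul_right h1 (1 / 2)
    _ = _ := by rw [cost, cost]; ring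

theorem cost_zero : cost C T (0 : ControlSpace U T) = 0 := by
  have h1 : ∫⁻ t in Ioo 0 T, gaugeFun C ((0 : ControlSpace U T) t) ^ 2 = 0 := by
    rw [lintegral_eq_zero_iff ((hC.measurable_gaugeFun_comp _).pow_const 2)]
    filter_upwards [Lp.coeFn_zero U 2 (volume.restrict (Ioo (0 : ℝ) T))] with t ht
    have : gaugeFun C (0 : U) ≤ ((0 : ℝ≥0) : ℝ≥0∞) :=
      hC.gaugeFun_le_coe_iff.2 ⟨0, hC.zero_mem, smul_zero _⟩
    rw [ht, Pi.zero_apply, Pi.zero_apply, nonpos_iff_eq_zero.1 this, zero_pow two_ne_zero]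
  rw [cost, h1, mul_zero]

/-- Fatou's lemma along an almost everywhere convergent subsequence, with a lower semicontinuous
integrand. -/
theorem isClosed_costBody : IsClosed (costBody C T) := by
  refine isSeqClosed_iff_isClosed.1 fun u v hu huv => ?_
  obtain ⟨ns, -, hns⟩ := (tendstoInMeasure_of_tendsto_Lp huv).exists_seq_tendsto_ae
  have hlsc : LowerSemicontinuous fun x => gaugeFun C x ^ 2 :=
    (ENNReal.continuous_pow 2).comp_lowerSemicontinuous hC.lowerSemicontinuous_gaugeFun
      (pow_left_mono 2)
  have h1 : ∫⁻ t in Ioo 0 T, gaugeFun C (v t) ^ 2 ≤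
      ∫⁻ t in Ioo 0 T, liminf (fun i => gaugeFun C (u (ns i) t) ^ 2) atTop := by
    refine lintegral_mono_ae ?_
    filter_upwards [hns] with t ht
    exact (hlsc.le_liminf (v t)).trans (liminf_le_liminf_of_le ht)
  have h2 := lintegral_liminf_le (μ := volume.restrict (Ioo 0 T)) (u := atTop)
    (f := fun i t => gaugeFun C (u (ns i) t) ^ 2)
    fun i => (hC.measurable_gaugeFun_comp (u (ns i))).pow_const 2
  have h3 : ∀ i, ∫⁻ t in Ioo 0 T, gaugeFun C (u (ns i) t) ^ 2 ≤ 1 := by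
    intro i
    have h4 : (1 / 2 : ℝ≥0∞) * _ ≤ 1 / 2 := hu (ns i)
    have h5 := mul_le_mul_right h4 2
    rwa [← mul_assoc, ENNReal.mul_div_cancel (by norm_num) (by norm_num), one_mul] at h5
  have h6 : liminf (fun i => ∫⁻ t in Ioo 0 T, gaugeFun C (u (ns i) t) ^ 2) atTop ≤ 1 :=
    liminf_le_of_frequently_le' (Eventually.of_forall h3).frequently
  change (1 / 2 : ℝ≥0∞) * _ ≤ 1 / 2
  calc _ ≤ _ := mul_le_mul_right ((h1.trans h2).trans h6) (1 / 2)
    _ = _ := mul_one _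

theorem isBounded_costBody : Bornology.IsBounded (costBody C T) := by
  obtain ⟨R, hR0, hR⟩ := hC.exists_norm_le
  lift R to ℝ≥0 using hR0.le
  have hR0' : R ≠ 0 := by rintro rfl; simp at hR0
  refine isBounded_iff_forall_norm_le.2 ⟨(((R : ℝ≥0∞) ^ 2) ^ (1 / 2 : ℝ)).toReal, fun u hu => ?_⟩
  have h1 : ∫⁻ t in Ioo 0 T, gaugeFun C (u t) ^ 2 ≤ 1 := by
    have h4 : (1 / 2 : ℝ≥0∞) * _ ≤ 1 / 2 := hu
    have h5 := mul_le_mul_right h4 2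
    rwa [← mul_assoc, ENNReal.mul_div_cancel (by norm_num) (by norm_num), one_mul] at h5
  rw [Lp.norm_def]
  refine ENNReal.toReal_mono
    (ENNReal.rpow_ne_top_of_nonneg (by norm_num) (ENNReal.pow_ne_top ENNReal.coe_ne_top)) ?_
  rw [eLpNorm_eq_lintegral_rpow_enorm_toReal (by norm_num) (by norm_num)]
  simp only [ENNReal.toReal_ofNat, ENNReal.rpow_two]
  refine ENNReal.rpow_le_rpow ?_ (by norm_num)
  calc ∫⁻ t in Ioo 0 T, ‖u t‖ₑ ^ 2 ≤ ∫⁻ t in Ioo 0 T, (R : ℝ≥0∞) ^ 2 * gaugeFun C (u t) ^ 2 := by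
        refine lintegral_mono fun t => ?_
        rw [← mul_pow]
        exact pow_le_pow_left' (hC.enorm_le_gaugeFun hR0' hR (u t)) 2
    _ = (R : ℝ≥0∞) ^ 2 * ∫⁻ t in Ioo 0 T, gaugeFun C (u t) ^ 2 :=
        lintegral_const_mul _ ((hC.measurable_gaugeFun_comp u).pow_const 2)
    _ ≤ (R : ℝ≥0∞) ^ 2 * 1 := by gcongr
    _ = _ := mul_one _

theorem costBody : IsConvexBody (costBody C T) where
  isClosed := hC.isClosed_costBody
  isBounded := hC.isBounded_costBody
  convex := by
    refine convex_iff_forall_pos.2 fun u hu v hv a b ha hb hab => ?_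
    lift a to ℝ≥0 using ha.le
    lift b to ℝ≥0 using hb.le
    have hab' : a + b = 1 := by exact_mod_cast hab
    refine (hC.cost_convex_comb_le u v (by exact_mod_cast ha) (by exact_mod_cast hb) hab').trans ?_
    calc (a : ℝ≥0∞) * cost C T u + b * cost C T v ≤ a * (1 / 2) + b * (1 / 2) := by
          gcongr
          exacts [hu, hv]
      _ = 1 / 2 := by rw [← add_mul, ← ENNReal.coe_add, hab', ENNReal.coe_one, one_mul]
  zero_mem := by
    change cost C T 0 ≤ 1 / 2
    rw [hC.cost_zero]
    exact zero_le

/-- Homogeneity of degree two settles `s > 0`. A control of zero cost lies in every positive dilate,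
hence in the zero one. This is what the conjugate and subdifferential formulas require. -/
theorem cost_le_iff {s : ℝ} (hs : 0 ≤ s) (u : ControlSpace U T) :
    cost C T u ≤ ENNReal.ofReal (s ^ 2 / 2) ↔ u ∈ s • ConicControl.costBody C T := by
  have hpos : ∀ s : ℝ, 0 < s →
      (cost C T u ≤ ENNReal.ofReal (s ^ 2 / 2) ↔ u ∈ s • ConicControl.costBody C T) := by
    intro s hs
    lift s to ℝ≥0 using hs.le
    have hs' : 0 < s := by exact_mod_cast hs
    have hsE : (s : ℝ≥0∞) ^ 2 ≠ 0 := by simpa using hs'.ne'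
    have hsT : (s : ℝ≥0∞) ^ 2 ≠ ⊤ := ENNReal.pow_ne_top ENNReal.coe_ne_top
    rw [mem_smul_set_iff_inv_smul_mem₀ hs.ne', ← NNReal.coe_inv]
    change _ ↔ cost C T _ ≤ _
    rw [hC.cost_smul (inv_pos.2 hs'), ENNReal.coe_inv hs'.ne', ← ENNReal.inv_pow, mul_comm,
      ← div_eq_mul_inv, ENNReal.div_le_iff hsE hsT]
    have : ENNReal.ofReal ((s : ℝ) ^ 2 / 2) = 1 / 2 * (s : ℝ≥0∞) ^ 2 := by
      rw [div_eq_mul_inv, ENNReal.ofReal_mul (by positivity), ENNReal.ofReal_pow s.coe_nonneg,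
        ENNReal.ofReal_coe_nnreal, mul_comm, ENNReal.ofReal_inv_of_pos two_pos]
      simp
    rw [this]
  rcases hs.eq_or_lt with rfl | hs
  · constructor
    · intro h
      refine hC.costBody.mem_smul_of_inner_le fun p => ?_
      have h1 : ∀ n : ℕ, ⟪u, p⟫ ≤
          1 / ((n : ℝ) + 1) * supportReal (ConicControl.costBody C T) p := by
        intro n
        rw [real_inner_comm]
        refine hC.costBody.inner_le_of_mem_smul p (by positivity) ?_
        rw [← hpos _ (by positivity)]
        refine h.trans (ENNReal.ofReal_le_ofReal ?_)
        rw [zero_pow two_ne_zero, zero_div]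
        positivity
      exact ge_of_tendsto' (tendsto_one_div_add_atTop_nhds_zero_nat.mul_const _) h1
    · rintro ⟨v, -, rfl⟩
      have h1 : (0 : ℝ) • v = 0 := zero_smul ℝ v
      have h2 : cost C T ((0 : ℝ) • v) = 0 := by
        rw [h1, hC.cost_zero]
      exact h2.le.trans zero_le
  · exact hpos s hs

theorem dualCost_eq (q : ControlSpace U T) :
    dualCost C T q = ((supportReal (ConicControl.costBody C T) q ^ 2 / 2 : ℝ) : EReal) :=
  hC.costBody.conjugate_eq (fun _ hs u => hC.cost_le_iff hs u) q

theorem subdifferential_dualCost (q : ControlSpace U T) :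
    subdifferential (dualCost C T) q = dualityMap (ConicControl.costBody C T) q :=
  hC.costBody.subdifferential_conjugate (fun _ hs u => hC.cost_le_iff hs u) q

end IsConvexBody

namespace IsConvexBody

/-! ### Pointwise subgradients and singular normals -/

section Pointwise

variable {U : Type*} [NormedAddCommGroup U] [InnerProductSpace ℝ U] {C : Set U}
  (hC : IsConvexBody C)

include hC

theorem supportReal_le_add_norm_sub {R : ℝ} (hR : ∀ x ∈ C, ‖x‖ ≤ R) (x y : U) :
    supportReal C x ≤ supportReal C y + R * ‖x - y‖ := by
  have h1 := hC.supportReal_add_le y (x - y)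
  rw [add_sub_cancel] at h1
  exact h1.trans (by gcongr; exact hC.supportReal_le_norm hR _)

/-- On a separable set, the support function is a supremum over countably many points. -/
theorem exists_countable_supportReal [CompleteSpace U] {V : Set U}
    (hV : TopologicalSpace.IsSeparable V) :
    ∃ D : Set U, D.Countable ∧ D ⊆ C ∧
      ∀ x ∈ V, ∀ ε > 0, ∃ w ∈ D, supportReal C x - ε ≤ ⟪x, w⟫ := by
  obtain ⟨c, hc, hVc⟩ := hV
  obtain ⟨R, hR0, hR⟩ := hC.exists_norm_le
  choose w hwC hw using hC.exists_inner_eq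
  refine ⟨w '' c, hc.image w, by rintro _ ⟨v, -, rfl⟩; exact hwC v, fun x hx ε hε => ?_⟩
  -- Passing from `x` to `v` costs at most `R ‖x - v‖` twice: in the support function and in the
  -- product with `w v`.
  obtain ⟨v, hv, hxv⟩ := Metric.mem_closure_iff.1 (hVc hx) (ε / (2 * R)) (by positivity)
  refine ⟨w v, ⟨v, hv, rfl⟩, ?_⟩
  rw [dist_eq_norm, lt_div_iff₀ (by positivity)] at hxv
  have h1 := hC.supportReal_le_add_norm_sub hR x v
  have h2 : ⟪v - x, w v⟫ ≤ ‖x - v‖ * R := by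
    refine (real_inner_le_norm _ _).trans ?_
    rw [norm_sub_rev]
    gcongr
    exact hR _ (hwC v)
  rw [inner_sub_left, hw v] at h2
  linarith

theorem supportFun_eq (v : U) : supportFun C v = (supportReal C v : EReal) := by
  refine le_antisymm (iSup₂_le fun y hy => EReal.coe_le_coe_iff.2 (hC.inner_le v hy)) ?_
  refine EReal.ge_of_forall_gt_iff_ge.1 fun z hz => ?_
  obtain ⟨_, ⟨w, hw, rfl⟩, h⟩ := exists_lt_of_lt_csSup (s := (fun w => ⟪v, w⟫) '' C)
    ⟨_, 0, hC.zero_mem, rfl⟩ (show z < sSup ((fun w => ⟪v, w⟫) '' C) from EReal.coe_lt_coe_iff.1 hz)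
  exact le_trans (EReal.coe_le_coe_iff.2 h.le)
    (le_iSup₂ (f := fun y (_ : y ∈ C) => ((⟪v, y⟫ : ℝ) : EReal)) w hw)

/-- As `0 ∈ C`, the support function is nonnegative, and it vanishes when no product with `C` is
positive. There `0` is the only subgradient of the half square, even if `v` is singular: this is why
(H) exempts the polar cone. -/
theorem mem_polar_coneOf_iff {v : U} : v ∈ polar (coneOf C) ↔ supportReal C v = 0 := by
  constructor
  · intro h
    refine le_antisymm (hC.supportReal_le fun w hw => ?_) (hC.supportReal_nonneg v)
    rw [real_inner_comm]
    exact h w ⟨1, one_pos, w, hw, (one_smul ℝ w).symm⟩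
  · rintro h _ ⟨r, hr, p, hp, rfl⟩
    rw [real_inner_smul_left, real_inner_comm]
    exact mul_nonpos_of_nonneg_of_nonpos hr.le (h ▸ hC.inner_le v hp)

theorem mem_sing_iff {v : U} : v ∈ sing C ↔
    ∃ a ∈ C, ∃ b ∈ C, a ≠ b ∧ ⟪v, a⟫ = supportReal C v ∧ ⟪v, b⟫ = supportReal C v := by
  simp only [sing, mem_ofPred_eq, hC.supportFun_eq, EReal.coe_eq_coe_iff]

omit hC in
theorem exists_smul_eq_of_mem_dualityMap {v u : U} (hv : 0 < supportReal C v)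
    (hu : u ∈ dualityMap C v) :
    ∃ w ∈ C, ⟪v, w⟫ = supportReal C v ∧ u = supportReal C v • w := by
  obtain ⟨⟨w, hw, rfl⟩, h⟩ := hu
  refine ⟨w, hw, ?_, rfl⟩
  change ⟪supportReal C v • w, v⟫ = _ at h
  rw [real_inner_smul_left, real_inner_comm, sq] at h
  exact mul_left_cancel₀ hv.ne' h

omit hC in
theorem smul_mem_dualityMap {v w : U} (hw : w ∈ C) (h : ⟪v, w⟫ = supportReal C v) :
    supportReal C v • w ∈ dualityMap C v := by
  refine ⟨⟨w, hw, rfl⟩, ?_⟩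
  rw [real_inner_smul_left, real_inner_comm, h, sq]

theorem eq_zero_of_mem_dualityMap {v u : U} (hv : supportReal C v = 0)
    (hu : u ∈ dualityMap C v) : u = 0 := by
  have := hu.1
  rw [hv, zero_smul_set ⟨0, hC.zero_mem⟩] at this
  exact this

/-- Half the squared support function has a unique subgradient at `v` exactly when `v` is regular
or belongs to the polar cone. -/
theorem subsingleton_dualityMap_iff {v : U} :
    (dualityMap C v).Subsingleton ↔ v ∉ sing C ∩ (polar (coneOf C))ᶜ := by
  rw [mem_inter_iff, mem_compl_iff, hC.mem_polar_coneOf_iff, hC.mem_sing_iff]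
  constructor
  · rintro h ⟨⟨a, ha, b, hb, hne, hva, hvb⟩, hv⟩
    exact hne (smul_right_injective U hv
      (h (smul_mem_dualityMap ha hva) (smul_mem_dualityMap hb hvb)))
  · intro h x hx y hy
    rcases (hC.supportReal_nonneg v).eq_or_lt with h0 | h0
    · rw [hC.eq_zero_of_mem_dualityMap h0.symm hx, hC.eq_zero_of_mem_dualityMap h0.symm hy]
    · obtain ⟨a, ha, hva, rfl⟩ := exists_smul_eq_of_mem_dualityMap h0 hx
      obtain ⟨b, hb, hvb, rfl⟩ := exists_smul_eq_of_mem_dualityMap h0 hy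
      by_contra hne
      exact h ⟨⟨a, ha, b, hb, fun hab => hne (by rw [hab]), hva, hvb⟩, h0.ne'⟩

/-- Either `u = 0`, or `u` is a positive multiple of the only maximiser of `⟪v, ·⟫` on `C`. In a
segment through that maximiser both ends are maximisers as well, so it is extreme. -/
theorem mem_coneOf_of_mem_dualityMap {v u : U} {𝒰 : Set U} (hzero : (0 : U) ∈ 𝒰)
    (hext : C.extremePoints ℝ ⊆ 𝒰) (hv : v ∉ sing C ∩ (polar (coneOf C))ᶜ)
    (hu : u ∈ dualityMap C v) : u ∈ coneOf 𝒰 := by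
  have hsub := hC.subsingleton_dualityMap_iff.2 hv
  rcases (hC.supportReal_nonneg v).eq_or_lt with h0 | h0
  · exact ⟨1, one_pos, 0, hzero, by rw [hC.eq_zero_of_mem_dualityMap h0.symm hu, smul_zero]⟩
  · obtain ⟨a, ha, hva, rfl⟩ := exists_smul_eq_of_mem_dualityMap h0 hu
    refine ⟨_, h0, a, hext (mem_extremePoints.2 ⟨ha, fun x hx y hy hxy => ?_⟩), rfl⟩
    have huniq : ∀ z ∈ C, ⟪v, z⟫ = supportReal C v → z = a := fun z hz hvz =>
      smul_right_injective U h0.ne' (hsub (smul_mem_dualityMap hz hvz) hu)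
    obtain ⟨r, s, hr, hs, hrs, rfl⟩ := hxy
    have hx1 := hC.inner_le v hx
    have hy1 := hC.inner_le v hy
    rw [inner_add_right, inner_smul_right, inner_smul_right] at hva
    have hsv : supportReal C v = r * supportReal C v + s * supportReal C v := by
      rw [← add_mul, hrs, one_mul]
    have hx2 := mul_le_mul_of_nonneg_left hx1 hr.le
    have hy2 := mul_le_mul_of_nonneg_left hy1 hs.le
    exact ⟨huniq x hx (mul_left_cancel₀ hr.ne' (by linarith)),
      huniq y hy (mul_left_cancel₀ hs.ne' (by linarith))⟩

end Pointwise

/-! ### From subgradients in `L²` to pointwise subgradients and back -/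

section Controls

variable {U : Type*} [NormedAddCommGroup U] [InnerProductSpace ℝ U] [CompleteSpace U]
  {C : Set U} (hC : IsConvexBody C) {T : ℝ}

include hC

/-- Young's inequality for the cost, stated with an integrable real majorant `β` of the squared
gauge so that all integrals are finite. -/
theorem inner_le_of_gaugeFun_le {v q : ControlSpace U T} {β : ℝ → ℝ}
    (hβ : Integrable β (volume.restrict (Ioo 0 T))) (hβ0 : ∀ t, 0 ≤ β t)
    (hv : ∀ᵐ t ∂volume.restrict (Ioo 0 T), gaugeFun C (v t) ^ 2 ≤ ENNReal.ofReal (β t)) :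
    ⟪v, q⟫ ≤ (∫ t in Ioo 0 T, β t) / 2 + supportReal (ConicControl.costBody C T) q ^ 2 / 2 := by
  set τ := ∫ t in Ioo 0 T, β t with hτ
  have hτ0 : 0 ≤ τ := integral_nonneg hβ0
  have h1 : cost C T v ≤ ENNReal.ofReal (√τ ^ 2 / 2) := by
    rw [Real.sq_sqrt hτ0, div_eq_mul_inv, mul_comm, ENNReal.ofReal_mul (by norm_num),
      ENNReal.ofReal_inv_of_pos two_pos, hτ,
      ofReal_integral_eq_lintegral_ofReal hβ (Eventually.of_forall hβ0), cost, one_div,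
      ENNReal.ofReal_ofNat]
    exact mul_le_mul_right (lintegral_mono_ae hv) _
  rw [hC.cost_le_iff (Real.sqrt_nonneg τ)] at h1
  have h2 := hC.costBody.inner_le_of_mem_smul q (Real.sqrt_nonneg τ) h1
  rw [real_inner_comm]
  nlinarith [sq_nonneg (√τ - supportReal (ConicControl.costBody C T) q), Real.sq_sqrt hτ0]

/-- Subgradients of the dual cost are pointwise subgradients. -/
theorem ae_mem_dualityMap {u q : ControlSpace U T}
    (hu : u ∈ dualityMap (ConicControl.costBody C T) q) :
    ∀ᵐ t ∂volume.restrict (Ioo 0 T), u t ∈ dualityMap C (q t) := by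
  set μ : Measure ℝ := volume.restrict (Ioo (0 : ℝ) T)
  set σ := supportReal (ConicControl.costBody C T) q
  have hσ0 : 0 ≤ σ := hC.costBody.supportReal_nonneg q
  have hcost : cost C T u ≤ ENNReal.ofReal (σ ^ 2 / 2) := (hC.cost_le_iff hσ0 u).2 hu.1
  have hg2 : ∫⁻ t, gaugeFun C (u t) ^ 2 ∂μ ≤ ENNReal.ofReal (σ ^ 2) := by
    have h1 : (1 / 2 : ℝ≥0∞) * _ ≤ _ := hcost
    have h2 := mul_le_mul_right h1 2
    rw [← mul_assoc, ENNReal.mul_div_cancel (by norm_num) (by norm_num), one_mul] at h2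
    have h3 : (2 : ℝ≥0∞) * ENNReal.ofReal (σ ^ 2 / 2) = ENNReal.ofReal (σ ^ 2) := by
      rw [← ENNReal.ofReal_ofNat 2, ← ENNReal.ofReal_mul (by norm_num),
        mul_div_cancel₀ _ two_ne_zero]
    exact h3 ▸ h2
  have hgT : ∫⁻ t, gaugeFun C (u t) ^ 2 ∂μ ≠ ⊤ := (hg2.trans_lt ENNReal.ofReal_lt_top).ne
  have hgm := (hC.measurable_gaugeFun_comp u).pow_const 2
  have hfin : ∀ᵐ t ∂μ, gaugeFun C (u t) ≠ ⊤ := by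
    filter_upwards [ae_lt_top hgm hgT] with t ht h
    simp [h] at ht
  set a2 : ℝ → ℝ := fun t => (gaugeFun C (u t) ^ 2).toReal with ha2
  have ha2i : Integrable a2 μ := integrable_toReal_of_lintegral_ne_top hgm.aemeasurable hgT
  have ha2b : ∫ t, a2 t ∂μ ≤ σ ^ 2 := by
    rw [integral_toReal hgm.aemeasurable (ae_lt_top hgm hgT)]
    exact ENNReal.toReal_le_of_le_ofReal (by positivity) hg2
  have huq : Integrable (fun t => ⟪u t, q t⟫) μ := L2.integrable_inner u q
  -- `u` maximises `⟪·, q⟫ - F`. Comparing it with the control equal to `r • w` on `A` and to `u`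
  -- elsewhere, for arbitrary `A`, localises this maximality.
  have key : ∀ w ∈ C, ∀ r : ℝ, 0 ≤ r →
      ∀ᵐ t ∂μ, r * ⟪w, q t⟫ - r ^ 2 / 2 ≤ ⟪u t, q t⟫ - a2 t / 2 := by
    intro w hw r hr
    have hqi : Integrable (q : ℝ → U) μ := (Lp.memLp q).integrable (by norm_num)
    have hwq : Integrable (fun t => r * ⟪w, q t⟫ - r ^ 2 / 2) μ :=
      ((hqi.const_inner w).const_mul r).sub (integrable_const _)
    have hψ : Integrable (fun t => ⟪u t, q t⟫ - a2 t / 2) μ := huq.sub (ha2i.div_const 2)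
    refine ae_le_of_forall_setIntegral_le hwq hψ fun A hA _ => ?_
    classical
    have hmem : MemLp (A.piecewise (fun _ => r • w) (u : ℝ → U)) 2 μ :=
      (memLp_const (r • w)).piecewise hA ((Lp.memLp u).restrict _)
    set v : ControlSpace U T := hmem.toLp _
    set β : ℝ → ℝ := A.piecewise (fun _ => r ^ 2) a2 with hβ
    have hβi : Integrable β μ :=
      Integrable.piecewise hA (integrable_const _).integrableOn ha2i.integrableOn
    have hβ0 : ∀ t, 0 ≤ β t := by
      intro t
      by_cases ht : t ∈ A
      · simp only [hβ, piecewise_eq_of_mem _ _ _ ht]; positivity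
      · simp only [hβ, piecewise_eq_of_notMem _ _ _ ht]; exact ENNReal.toReal_nonneg
    have hvt : ∀ᵐ t ∂μ, v t = A.piecewise (fun _ => r • w) (u : ℝ → U) t := hmem.coeFn_toLp
    have hle := hC.inner_le_of_gaugeFun_le (v := v) (q := q) hβi hβ0 (by
      filter_upwards [hvt, hfin] with t ht htop
      rw [ht]
      by_cases htA : t ∈ A
      · simp only [hβ, piecewise_eq_of_mem _ _ _ htA]
        lift r to ℝ≥0 using hr
        rw [ENNReal.ofReal_pow r.coe_nonneg, ENNReal.ofReal_coe_nnreal]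
        exact pow_le_pow_left' (hC.gaugeFun_le_coe_iff.2 ⟨w, hw, rfl⟩) 2
      · simp only [hβ, piecewise_eq_of_notMem _ _ _ htA, ha2]
        rw [ENNReal.ofReal_toReal (ENNReal.pow_ne_top htop)])
    have hle2 : ∫ t, (⟪v t, q t⟫ - β t / 2) ∂μ ≤ ∫ t, (⟪u t, q t⟫ - a2 t / 2) ∂μ := by
      rw [integral_sub (L2.integrable_inner v q) (hβi.div_const 2), integral_div,
        integral_sub huq (ha2i.div_const 2), integral_div]
      have h1 : ∫ t, ⟪u t, q t⟫ ∂μ = σ ^ 2 := by rw [← hu.2, L2.inner_def]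
      rw [L2.inner_def] at hle
      rw [h1]
      linarith
    have hpw : ∫ t, (⟪v t, q t⟫ - β t / 2) ∂μ =
        ∫ t, A.piecewise (fun t => r * ⟪w, q t⟫ - r ^ 2 / 2)
          (fun t => ⟪u t, q t⟫ - a2 t / 2) t ∂μ := by
      refine integral_congr_ae ?_
      filter_upwards [hvt] with t ht
      rw [ht]
      by_cases htA : t ∈ A
      · simp only [hβ, piecewise_eq_of_mem _ _ _ htA, real_inner_smul_left]
      · simp only [hβ, piecewise_eq_of_notMem _ _ _ htA]
    rw [hpw, integral_piecewise hA hwq.integrableOn hψ.integrableOn,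
      ← integral_add_compl hA hψ] at hle2
    linarith
  obtain ⟨D, hDc, hDC, hD⟩ :=
    hC.exists_countable_supportReal (Lp.stronglyMeasurable q).isSeparable_range
  -- Countably many tests share one null set; absolute values keep the factors nonnegative while `r`
  -- runs over a dense set of reals.
  have hall : ∀ᵐ t ∂μ, ∀ w ∈ D, ∀ r : ℚ, |(r : ℝ)| * ⟪w, q t⟫ - |(r : ℝ)| ^ 2 / 2 ≤
      ⟪u t, q t⟫ - a2 t / 2 := by
    rw [ae_ball_iff hDc]
    intro w hw
    rw [ae_all_iff]
    exact fun r => key w (hDC hw) _ (abs_nonneg _)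
  filter_upwards [hall, hfin] with t ht htop
  set m := ⟪u t, q t⟫ - a2 t / 2 with hm
  set s := supportReal C (q t) with hs
  have hs0 : 0 ≤ s := hC.supportReal_nonneg _
  have h1 : ∀ w ∈ D, s * ⟪w, q t⟫ - s ^ 2 / 2 ≤ m := by
    intro w hw
    have hcl : IsClosed {r : ℝ | |r| * ⟪w, q t⟫ - |r| ^ 2 / 2 ≤ m} :=
      isClosed_le (by fun_prop) continuous_const
    have h2 := Rat.denseRange_cast.induction_on (p := fun r : ℝ => |r| * ⟪w, q t⟫ - |r| ^ 2 / 2 ≤ m)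
      s hcl (ht w hw)
    rwa [abs_of_nonneg hs0] at h2
  have h2 : s ^ 2 / 2 ≤ m := by
    have h3 : ∀ n : ℕ, s * (s - 1 / ((n : ℝ) + 1)) - s ^ 2 / 2 ≤ m := by
      intro n
      obtain ⟨w, hw, hsw⟩ := hD (q t) (mem_range_self t) (1 / ((n : ℝ) + 1)) (by positivity)
      refine le_trans ?_ (h1 w hw)
      rw [real_inner_comm]
      gcongr
    have h4 : Tendsto (fun n : ℕ => s * (s - 1 / ((n : ℝ) + 1)) - s ^ 2 / 2) atTop
        (𝓝 (s * (s - 0) - s ^ 2 / 2)) :=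
      ((tendsto_const_nhds.sub tendsto_one_div_add_atTop_nhds_zero_nat).const_mul s).sub_const _
    have h5 := le_of_tendsto' h4 h3
    nlinarith
  have ha0 : 0 ≤ (gaugeFun C (u t)).toReal := ENNReal.toReal_nonneg
  have hmem := hC.gaugeFun_toReal_mem htop
  have h3 := hC.inner_le_of_mem_smul (q t) ha0 hmem
  rw [real_inner_comm] at h3
  have h4 : a2 t = (gaugeFun C (u t)).toReal ^ 2 := ENNReal.toReal_pow _ _
  set a := (gaugeFun C (u t)).toReal
  rw [h4] at hm
  -- From `s² / 2 ≤ ⟪u t, q t⟫ - a² / 2` and `⟪u t, q t⟫ ≤ a s`.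
  have h5 : a = s := by
    have : (a - s) ^ 2 ≤ 0 := by nlinarith
    exact sub_eq_zero.1 (pow_eq_zero_iff two_ne_zero |>.1 (le_antisymm this (sq_nonneg _)))
  refine ⟨?_, le_antisymm ?_ ?_⟩
  · rw [← hs, ← h5]; exact hmem
  · rw [h5] at h3; rw [sq]; exact h3
  · rw [h5] at hm; linarith

theorem subsingleton_dualityMap_costBody {q : ControlSpace U T}
    (h : ∀ᵐ t ∂volume.restrict (Ioo 0 T), q t ∉ sing C ∩ (polar (coneOf C))ᶜ) :
    (dualityMap (ConicControl.costBody C T) q).Subsingleton := by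
  intro u hu v hv
  refine Lp.ext ?_
  filter_upwards [h, hC.ae_mem_dualityMap hu, hC.ae_mem_dualityMap hv] with t ht hut hvt
  exact hC.subsingleton_dualityMap_iff.2 ht hut hvt

/-- If the dual cost has a unique subgradient at `q`, then almost every value of `q` has a unique
pointwise subgradient. -/
theorem ae_notMem_of_dualityMap_eq_singleton [TopologicalSpace.SeparableSpace U]
    {q u : ControlSpace U T} (hu : dualityMap (ConicControl.costBody C T) q = {u}) :
    ∀ᵐ t ∂volume.restrict (Ioo 0 T), q t ∉ sing C ∩ (polar (coneOf C))ᶜ := by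
  set μ : Measure ℝ := volume.restrict (Ioo (0 : ℝ) T)
  have huq : u ∈ dualityMap (ConicControl.costBody C T) q := hu ▸ mem_singleton u
  -- The null set depends on `e` but not on `w`, so no subgradient has to be chosen measurably in
  -- `t`.
  have key : ∀ e : U, ∀ᵐ t ∂μ, ∀ w ∈ dualityMap C (q t), ⟪w, e⟫ ≤ ⟪u t, e⟫ := by
    intro e
    set h : ControlSpace U T := Lp.const 2 μ e
    have hht : ∀ᵐ t ∂μ, h t = e := Lp.coeFn_const 2 μ e
    choose v hv using fun k : ℕ =>
      hC.costBody.dualityMap_nonempty (q + (1 / ((k : ℝ) + 1)) • h)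
    have hcoe : ∀ᵐ t ∂μ, ∀ k : ℕ, (q + (1 / ((k : ℝ) + 1)) • h : ControlSpace U T) t =
        q t + (1 / ((k : ℝ) + 1)) • e := by
      rw [ae_all_iff]
      intro k
      filter_upwards [hht, Lp.coeFn_smul (1 / ((k : ℝ) + 1)) h,
        Lp.coeFn_add q ((1 / ((k : ℝ) + 1)) • h)] with t h1 h2 h3
      rw [h3, Pi.add_apply, h2, Pi.smul_apply, h1]
    have hvt : ∀ᵐ t ∂μ, ∀ k : ℕ, v k t ∈ dualityMap C (q t + (1 / ((k : ℝ) + 1)) • e) := by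
      have h1 : ∀ᵐ t ∂μ, ∀ k : ℕ, v k t ∈
          dualityMap C ((q + (1 / ((k : ℝ) + 1)) • h : ControlSpace U T) t) :=
        ae_all_iff.2 fun k => hC.ae_mem_dualityMap (hv k)
      filter_upwards [h1, hcoe] with t h1 h2 k
      exact h2 k ▸ h1 k
    -- Monotonicity of the pointwise subdifferential between `q t` and its translate by a positive
    -- multiple of `e`.
    have hmono : ∀ᵐ t ∂μ, ∀ w ∈ dualityMap C (q t), ∀ k : ℕ, ⟪w, e⟫ ≤ ⟪v k t, e⟫ := by
      filter_upwards [hvt] with t ht w hw k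
      have h1 := hC.inner_sub_sub_nonneg (ht k) hw
      rw [add_sub_cancel_left, inner_smul_right, inner_sub_left] at h1
      have h2 : 0 < 1 / ((k : ℝ) + 1) := by positivity
      exact sub_nonneg.1 (nonneg_of_mul_nonneg_right h1 h2)
    have hut := hC.ae_mem_dualityMap huq
    have hsub : ∀ᵐ t ∂μ, ∀ k : ℕ, (v k - u : ControlSpace U T) t = v k t - u t :=
      ae_all_iff.2 fun k => Lp.coeFn_sub (v k) u
    set f : ℕ → ℝ → ℝ := fun k t => ⟪(v k - u : ControlSpace U T) t, h t⟫ with hf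
    have hfi : ∀ k, Integrable (f k) μ := fun k => L2.integrable_inner (v k - u) h
    have hfe : ∀ᵐ t ∂μ, ∀ k, f k t = ⟪v k t, e⟫ - ⟪u t, e⟫ := by
      filter_upwards [hsub, hht] with t h1 h2 k
      simp only [hf, h1 k, h2, inner_sub_left]
    have hf0 : ∀ k, 0 ≤ᵐ[μ] f k := by
      intro k
      filter_upwards [hfe, hmono, hut] with t h1 h2 h3
      rw [h1 k]
      exact sub_nonneg.2 (h2 _ h3 k)
    -- The integrals of the nonnegative `f k` come arbitrarily close to zero because `u` is the only
    -- subgradient at `q`; so their infimum vanishes almost everywhere.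
    have hzero : ∫⁻ t, ⨅ k, ENNReal.ofReal (f k t) ∂μ = 0 := by
      refine le_antisymm (ENNReal.le_of_forall_pos_le_add fun ε hε _ => ?_) zero_le
      obtain ⟨k, hk⟩ := hC.costBody.exists_inner_sub_lt hu h hv (ε := ε) (by exact_mod_cast hε)
      rw [zero_add]
      calc ∫⁻ t, ⨅ k, ENNReal.ofReal (f k t) ∂μ ≤ ∫⁻ t, ENNReal.ofReal (f k t) ∂μ :=
            lintegral_mono fun t => iInf_le _ k
        _ = ENNReal.ofReal (∫ t, f k t ∂μ) :=
            (ofReal_integral_eq_lintegral_ofReal (hfi k) (hf0 k)).symm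
        _ ≤ ENNReal.ofReal ε := by
            rw [L2.inner_def] at hk
            exact ENNReal.ofReal_le_ofReal hk.le
        _ = ε := ENNReal.ofReal_coe_nnreal
    rw [lintegral_eq_zero_iff' (AEMeasurable.iInf fun k => (hfi k).1.aemeasurable.ennreal_ofReal)]
      at hzero
    filter_upwards [hzero, hfe, hmono] with t h1 h2 h3 w hw
    by_contra! hlt
    have h4 : ENNReal.ofReal (⟪w, e⟫ - ⟪u t, e⟫) ≤ ⨅ k, ENNReal.ofReal (f k t) := by
      refine le_iInf fun k => ENNReal.ofReal_le_ofReal ?_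
      rw [h2 k]
      exact sub_le_sub_right (h3 w hw k) _
    rw [h1, Pi.zero_apply, nonpos_iff_eq_zero, ENNReal.ofReal_eq_zero] at h4
    linarith
  have hall : ∀ᵐ t ∂μ, ∀ n : ℕ, ∀ w ∈ dualityMap C (q t),
      ⟪w, TopologicalSpace.denseSeq U n⟫ ≤ ⟪u t, TopologicalSpace.denseSeq U n⟫ :=
    ae_all_iff.2 fun n => key _
  filter_upwards [hall] with t ht
  rw [← hC.subsingleton_dualityMap_iff]
  have heq : ∀ w ∈ dualityMap C (q t), w = u t := by
    intro w hw
    -- By density the direction `w - u t`, which depends on `t`, is allowed, and it gives `‖w - u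
    -- t‖² ≤ 0`.
    have h1 := (TopologicalSpace.denseRange_denseSeq U).induction_on
      (p := fun e => ⟪w, e⟫ ≤ ⟪u t, e⟫) (w - u t) (isClosed_le (by fun_prop) (by fun_prop))
      fun n => ht n w hw
    rw [← sub_nonpos, ← inner_sub_left, real_inner_self_eq_norm_sq] at h1
    exact sub_eq_zero.1 (norm_eq_zero.1 (pow_eq_zero_iff two_ne_zero |>.1
      (le_antisymm h1 (sq_nonneg _))))
  intro x hx y hy
  rw [heq x hx, heq y hy]

end Controls

end IsConvexBody

/-! ### Extended real square roots and quotients -/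

theorem sqrtE_coe {r : ℝ} (hr : 0 ≤ r) : sqrtE (r : EReal) = ((√r : ℝ) : EReal) := by
  rw [sqrtE, EReal.toENNReal_of_ne_top (EReal.coe_ne_top r), EReal.toReal_coe,
    ENNReal.ofReal_rpow_of_nonneg hr (by norm_num), ← Real.sqrt_eq_rpow, EReal.coe_ennreal_ofReal,
    max_eq_left (Real.sqrt_nonneg r)]

/-- The conventions at `b = 0` are made for this: the quotient is then at most `c` exactly when `a ≤
0`, and `0 / 0 = 0` agrees because `0 ≤ c`. -/
theorem quot_le_coe_iff {a b c : ℝ} (hb : 0 ≤ b) (hc : 0 ≤ c) :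
    quot a (b : EReal) ≤ (c : EReal) ↔ a ≤ c * b := by
  rcases hb.eq_or_lt with rfl | hb
  · rw [quot, EReal.coe_zero, if_pos rfl, mul_zero]
    split_ifs with h1 h2
    · simpa [h1] using hc
    · simpa using h2
    · simpa using not_lt.1 h2
  · rw [quot, if_neg (by exact_mod_cast hb.ne'), ← EReal.coe_div, EReal.coe_le_coe_iff,
      div_le_iff₀ hb]

theorem quot_of_pos {a b : ℝ} (hb : 0 < b) : quot a (b : EReal) = ((a / b : ℝ) : EReal) := by
  rw [quot, if_neg (by exact_mod_cast hb.ne'), ← EReal.coe_div]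

theorem quot_nonneg {a b : ℝ} (ha : 0 ≤ a) (hb : 0 ≤ b) : 0 ≤ quot a (b : EReal) := by
  rcases hb.eq_or_lt with rfl | hb
  · rw [quot, EReal.coe_zero, if_pos rfl]
    split_ifs with h1 h2
    · exact le_rfl
    · exact le_top
    · exact absurd (lt_of_le_of_ne ha (Ne.symm h1)) h2
  · rw [quot_of_pos hb]
    exact_mod_cast div_nonneg ha hb.le

/-! ### Minimising `N² - ⟪y, ·⟫` for positively homogeneous `N` -/

section PositivelyHomogeneous

variable {X : Type*} [NormedAddCommGroup X] [InnerProductSpace ℝ X] {N : X → ℝ} {y : X}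
  (hN : ∀ p, 0 ≤ N p) (hs : ∀ (a : ℝ) p, 0 ≤ a → N (a • p) = a * N p)

include hN

/-- One of `p` and `-p` has a nonnegative product with `y`; nontriviality of `X` provides a unit
vector. -/
theorem iSup_quot_nonneg [Nontrivial X] :
    0 ≤ ⨆ p ∈ Metric.sphere (0 : X) 1, quot ⟪y, p⟫ (N p : EReal) := by
  obtain ⟨p, hp⟩ := exists_norm_eq X zero_le_one
  rcases le_total 0 ⟪y, p⟫ with h | h
  · exact (quot_nonneg h (hN p)).trans
      (le_iSup₂ (f := fun p (_ : p ∈ Metric.sphere (0 : X) 1) => quot ⟪y, p⟫ (N p : EReal)) p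
        (by simpa using hp))
  · have h' : 0 ≤ ⟪y, -p⟫ := by rw [inner_neg_right]; linarith
    exact (quot_nonneg h' (hN (-p))).trans
      (le_iSup₂ (f := fun p (_ : p ∈ Metric.sphere (0 : X) 1) => quot ⟪y, p⟫ (N p : EReal)) (-p)
        (by simpa using hp))

include hs

theorem iSup_quot_le_coe_iff {c : ℝ} (hc : 0 ≤ c) :
    ⨆ p ∈ Metric.sphere (0 : X) 1, quot ⟪y, p⟫ (N p : EReal) ≤ (c : EReal) ↔
      ∀ p, ⟪y, p⟫ ≤ c * N p := by
  simp only [iSup_le_iff, quot_le_coe_iff (hN _) hc]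
  constructor
  · intro h p
    rcases eq_or_ne p 0 with rfl | hp
    · rw [inner_zero_right]
      exact mul_nonneg hc (hN 0)
    · have hp' : 0 < ‖p‖ := norm_pos_iff.2 hp
      have h1 := h (‖p‖⁻¹ • p) (by simp [norm_smul, hp'.ne'])
      rw [hs _ _ (by positivity), inner_smul_right, mul_left_comm] at h1
      exact le_of_mul_le_mul_left h1 (by positivity)
  · exact fun h p _ => h p

/-- The two expressions of the optimal constant agree. -/
theorem iSup_quot_eq_iInf [Nontrivial X] :
    ⨆ p ∈ Metric.sphere (0 : X) 1, quot ⟪y, p⟫ (N p : EReal) =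
      ⨅ (c : ℝ) (_ : 0 ≤ c ∧ ∀ p, ⟪y, p⟫ ≤ c * N p), (c : EReal) := by
  have h0 := iSup_quot_nonneg (y := y) hN
  refine le_antisymm (le_iInf₂ fun c hc => (iSup_quot_le_coe_iff hN hs hc.1).2 hc.2) ?_
  generalize hS : ⨆ p ∈ Metric.sphere (0 : X) 1, quot ⟪y, p⟫ (N p : EReal) = S at h0
  induction S with
  | bot => exact absurd h0 (by simp)
  | top => exact le_top
  | coe c =>
    have hc : 0 ≤ c := by exact_mod_cast h0
    exact iInf₂_le c ⟨hc, (iSup_quot_le_coe_iff hN hs hc).1 hS.le⟩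

theorem exists_bound_iff_iSup_quot_lt_top [Nontrivial X] :
    (∃ c : ℝ, 0 < c ∧ ∀ p, ⟪y, p⟫ ≤ c * N p) ↔
      ⨆ p ∈ Metric.sphere (0 : X) 1, quot ⟪y, p⟫ (N p : EReal) < ⊤ := by
  constructor
  · rintro ⟨c, hc, h⟩
    exact ((iSup_quot_le_coe_iff hN hs hc.le).2 h).trans_lt (EReal.coe_lt_top c)
  · intro h
    have h0 := iSup_quot_nonneg (y := y) hN
    generalize hS : ⨆ p ∈ Metric.sphere (0 : X) 1, quot ⟪y, p⟫ (N p : EReal) = S at h0 h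
    induction S with
    | bot => exact absurd h0 (by simp)
    | top => exact absurd h (lt_irrefl _)
    | coe c =>
      have hc : 0 ≤ c := by exact_mod_cast h0
      refine ⟨c + 1, by linarith, fun p => ?_⟩
      have := (iSup_quot_le_coe_iff hN hs hc).1 hS.le p
      linarith [hN p]

/-- Optimality conditions for a minimiser of `N² - ⟪y, ·⟫`. -/
theorem inner_eq_and_le_of_isMin {c : ℝ} (hc : ∀ p, ⟪y, p⟫ ≤ c * N p) {p : X}
    (hp : ∀ p', N p ^ 2 - ⟪y, p⟫ ≤ N p' ^ 2 - ⟪y, p'⟫) :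
    ⟪y, p⟫ = 2 * N p ^ 2 ∧ ∀ p', ⟪y, p'⟫ ≤ 2 * N p * N p' := by
  have hscale : ∀ (p' : X) (a : ℝ), 0 ≤ a →
      N p ^ 2 - ⟪y, p⟫ ≤ a ^ 2 * N p' ^ 2 - a * ⟪y, p'⟫ := by
    intro p' a ha
    have := hp (a • p')
    rwa [hs a p' ha, inner_smul_right, mul_pow] at this
  have hnonneg : N p ^ 2 ≤ ⟪y, p⟫ := by
    have := hscale p 0 le_rfl
    linarith
  have heq : ⟪y, p⟫ = 2 * N p ^ 2 := by
    rcases (hN p).eq_or_lt with h0 | h0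
    · have := hc p
      rw [← h0] at this hnonneg ⊢
      linarith
    · set d := ⟪y, p⟫ with hd
      have hd0 : 0 ≤ d := (sq_nonneg _).trans hnonneg
      -- This factor minimises `a² N(p)² - a d`, with value `-d² / (4 N(p)²)`.
      have h1 := hscale p (d / (2 * N p ^ 2)) (by positivity)
      have h2 : (d / (2 * N p ^ 2)) ^ 2 * N p ^ 2 - d / (2 * N p ^ 2) * d =
          - (d ^ 2 / (4 * N p ^ 2)) := by field_simp; ring
      rw [h2, le_neg, div_le_iff₀ (by positivity)] at h1
      have h3 : (d - 2 * N p ^ 2) ^ 2 ≤ 0 := by nlinarith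
      exact sub_eq_zero.1 (pow_eq_zero_iff two_ne_zero |>.1 (le_antisymm h3 (sq_nonneg _)))
  refine ⟨heq, fun p' => ?_⟩
  rw [heq] at hscale
  have hNp := hN p
  rcases le_or_gt ⟪y, p'⟫ 0 with h | h
  · exact h.trans (mul_nonneg (by positivity) (hN p'))
  · rcases (hN p').eq_or_lt with h0 | h0
    · exact absurd h (not_lt.2 (by simpa [← h0] using hc p'))
    · set d := ⟪y, p'⟫ with hd
      have h1 := hscale p' (d / (2 * N p' ^ 2)) (by positivity)
      have h2 : (d / (2 * N p' ^ 2)) ^ 2 * N p' ^ 2 - d / (2 * N p' ^ 2) * d =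
          - (d ^ 2 / (4 * N p' ^ 2)) := by field_simp; ring
      rw [h2, le_neg, div_le_iff₀ (by positivity)] at h1
      have hNp' := hN p'
      exact abs_le_of_sq_le_sq' (by nlinarith) (by positivity) |>.2

/-- `N² - ⟪y, ·⟫` has a minimiser exactly when the optimal constant is attained. -/
theorem exists_isMin_iff_exists_quot_eq [Nontrivial X]
    (hbd : ∃ c : ℝ, 0 < c ∧ ∀ p, ⟪y, p⟫ ≤ c * N p) :
    (∃ p, ∀ p', N p ^ 2 - ⟪y, p⟫ ≤ N p' ^ 2 - ⟪y, p'⟫) ↔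
      ∃ p ∈ Metric.sphere (0 : X) 1, quot ⟪y, p⟫ (N p : EReal) =
        ⨆ p ∈ Metric.sphere (0 : X) 1, quot ⟪y, p⟫ (N p : EReal) := by
  have h0 := iSup_quot_nonneg (y := y) hN
  obtain ⟨c, hcS, hc0⟩ : ∃ c : ℝ,
      ⨆ p ∈ Metric.sphere (0 : X) 1, quot ⟪y, p⟫ (N p : EReal) = (c : EReal) ∧ 0 ≤ c := by
    have h := (exists_bound_iff_iSup_quot_lt_top hN hs).1 hbd
    generalize ⨆ p ∈ Metric.sphere (0 : X) 1, quot ⟪y, p⟫ (N p : EReal) = S at h0 h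
    induction S with
    | bot => exact absurd h0 (by simp)
    | top => exact absurd h (lt_irrefl _)
    | coe c => exact ⟨c, rfl, by exact_mod_cast h0⟩
  have hc := (iSup_quot_le_coe_iff (y := y) hN hs hc0).1 hcS.le
  -- If `c = 0`, testing the bound at `y` itself gives `‖y‖² ≤ 0`.
  have hy : c = 0 → y = 0 := by
    rintro rfl
    have := hc y
    rw [zero_mul, real_inner_self_eq_norm_sq] at this
    exact norm_eq_zero.1 (pow_eq_zero_iff two_ne_zero |>.1 (le_antisymm this (sq_nonneg _)))
  rw [hcS]
  constructor
  · rintro ⟨p, hp⟩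
    obtain ⟨h1, h2⟩ := inner_eq_and_le_of_isMin hN hs hc hp
    have h3 : c ≤ 2 * N p := by
      have h4 := (iSup_quot_le_coe_iff hN hs (mul_nonneg two_pos.le (hN p))).2 h2
      rw [hcS] at h4
      exact_mod_cast h4
    rcases (hN p).eq_or_lt with h5 | h5
    -- Here `y = 0`, so every unit vector has quotient `0`, under the convention `0 / 0 = 0` if
    -- needed.
    · have hc' : c = 0 := le_antisymm (by linarith) hc0
      obtain ⟨e, he⟩ := exists_norm_eq X zero_le_one
      refine ⟨e, by simpa using he, ?_⟩
      rw [hy hc', inner_zero_left, hc']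
      simp [quot]
    · have hcp : c = 2 * N p := by
        refine le_antisymm h3 ?_
        have := hc p
        rw [h1] at this
        nlinarith
      have hp0 : p ≠ 0 := by
        rintro rfl
        rw [inner_zero_right] at h1
        nlinarith
      have hp' : 0 < ‖p‖ := norm_pos_iff.2 hp0
      refine ⟨‖p‖⁻¹ • p, by simp [norm_smul, hp'.ne'], ?_⟩
      rw [hs _ _ (by positivity), inner_smul_right, quot_of_pos (by positivity), h1, hcp]
      congr 1
      field_simp
  · rintro ⟨p, -, hp⟩
    rcases (hN p).eq_or_lt with h5 | h5
    · have h6 : ⟪y, p⟫ ≤ 0 := by simpa [← h5] using hc p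
      -- The quotient has zero denominator and nonpositive numerator, so it is `0` or `⊥`; being
      -- real, it is `0`.
      have hc' : c = 0 := by
        rw [← h5, quot, EReal.coe_zero, if_pos rfl, if_neg (c := 0 < ⟪y, p⟫) h6.not_gt] at hp
        split_ifs at hp
        · exact_mod_cast hp.symm
        · exact absurd hp (EReal.bot_ne_coe c)
      refine ⟨0, fun p' => ?_⟩
      have h7 : N (0 : X) = 0 := by simpa using hs 0 0 le_rfl
      rw [hy hc', inner_zero_left, inner_zero_left, h7]
      nlinarith [sq_nonneg (N p')]
    · rw [quot_of_pos h5, EReal.coe_eq_coe_iff, div_eq_iff h5.ne'] at hp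
      -- Rescaled so that `N = c / 2`, the maximiser gives the value `-c² / 4`, a lower bound of `N²
      -- - c N`.
      have ha : 0 ≤ c / (2 * N p) := by positivity
      refine ⟨(c / (2 * N p)) • p, fun p' => ?_⟩
      rw [hs _ _ ha, inner_smul_right, hp]
      have h6 : (c / (2 * N p) * N p) ^ 2 - c / (2 * N p) * (c * N p) = - (c ^ 2 / 4) := by
        field_simp; ring
      rw [h6]
      nlinarith [hc p', sq_nonneg (N p' - c / 2)]

end PositivelyHomogeneous

theorem isConvexBody_relaxed {H : Type*} [NormedAddCommGroup H] [InnerProductSpace ℝ H]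
    {K : Set H} (hK : Bornology.IsBounded K) (h0 : (0 : H) ∈ K) : IsConvexBody (relaxed K) where
  isClosed := isClosed_closure
  convex := (convex_convexHull ℝ K).closure
  isBounded := (isBounded_convexHull.2 hK).closure
  zero_mem := subset_closure (subset_convexHull ℝ K h0)

/-! ### Reachability and dual minimisers -/

section Duality

variable {X U : Type*} [NormedAddCommGroup X] [InnerProductSpace ℝ X] [CompleteSpace X]
  [NormedAddCommGroup U] [InnerProductSpace ℝ U] [CompleteSpace U]
  (S : C0Semigroup X) (B : U →L[ℝ] X) (T : ℝ) (C : Set U) (y₀ yf : X)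

theorem steers_iff (u : ControlSpace U T) :
    Steers S B T y₀ yf u ↔ inputMap S B T u = shiftedTarget S T y₀ yf := by
  rw [shiftedTarget, eq_sub_iff_add_eq, add_comm, inputMap_apply]
  rfl

/-- The square root of the dual cost at `L_T^* p`. -/
noncomputable def dualNorm (p : X) : ℝ :=
  supportReal (costBody C T) (inputMapAdj S B T p) / √2

namespace IsConvexBody

variable {C} (hC : IsConvexBody C)

include hC

theorem dualNorm_nonneg (p : X) : 0 ≤ dualNorm S B T C p :=
  div_nonneg (hC.costBody.supportReal_nonneg _) (Real.sqrt_nonneg 2)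

theorem dualNorm_smul (a : ℝ) (p : X) (ha : 0 ≤ a) :
    dualNorm S B T C (a • p) = a * dualNorm S B T C p := by
  rw [dualNorm, dualNorm, map_smul, hC.costBody.supportReal_smul _ ha, mul_div_assoc]

omit hC in
theorem dualNorm_sq (p : X) :
    dualNorm S B T C p ^ 2 =
      supportReal (ConicControl.costBody C T) (inputMapAdj S B T p) ^ 2 / 2 := by
  rw [dualNorm, div_pow, Real.sq_sqrt two_pos.le]

theorem sqrtE_dualCost (p : X) :
    sqrtE (dualCost C T (inputMapAdj S B T p)) = (dualNorm S B T C p : EReal) := by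
  rw [hC.dualCost_eq, sqrtE_coe (by positivity), ← dualNorm_sq,
    Real.sqrt_sq (hC.dualNorm_nonneg S B T p)]

theorem dualBound_iff (c : ℝ) : DualBound S B T C y₀ yf c ↔
    ∀ p, ⟪shiftedTarget S T y₀ yf, p⟫ ≤ c * dualNorm S B T C p := by
  simp only [DualBound, hC.sqrtE_dualCost, ← EReal.coe_mul, EReal.coe_le_coe_iff]

theorem dualQuot_eq (p : X) : dualQuot S B T C y₀ yf p =
    quot ⟪shiftedTarget S T y₀ yf, p⟫ (dualNorm S B T C p : EReal) := by
  rw [dualQuot, hC.sqrtE_dualCost]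

theorem isDualMinimiser_iff (p : X) : IsDualMinimiser S B T C y₀ yf p ↔
    ∀ p', dualNorm S B T C p ^ 2 - ⟪shiftedTarget S T y₀ yf, p⟫ ≤
      dualNorm S B T C p' ^ 2 - ⟪shiftedTarget S T y₀ yf, p'⟫ := by
  simp only [IsDualMinimiser, isMinOn_univ_iff, dualFunctional, hC.dualCost_eq, ← dualNorm_sq,
    ← EReal.coe_sub, EReal.coe_le_coe_iff]

/-- Finite cost means membership in some dilate of `costBody`, and separation characterises the
image of a dilate. The cone constraint is automatic: a finite cost forces a finite gauge almost
everywhere. -/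
theorem exactlyReachable_iff :
    ExactlyReachable S B T (coneOf C) (finiteCost C T) y₀ yf ↔
      ∃ c : ℝ, 0 < c ∧ DualBound S B T C y₀ yf c := by
  simp only [hC.dualBound_iff, ExactlyReachable, steers_iff]
  have h20 : 0 < √(2 : ℝ) := by positivity
  constructor
  · rintro ⟨u, hu, -, huy⟩
    have hfin : cost C T u ≠ ⊤ := ne_of_lt hu
    set τ := (cost C T u).toReal with hτ
    have hτ0 : 0 ≤ τ := ENNReal.toReal_nonneg
    have h1 : u ∈ √(2 * τ) • ConicControl.costBody C T := by
      rw [← hC.cost_le_iff (Real.sqrt_nonneg _), Real.sq_sqrt (by positivity),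
        mul_div_cancel_left₀ _ two_ne_zero, hτ, ENNReal.ofReal_toReal hfin]
    -- The summand `1` only makes the constant positive.
    refine ⟨√(2 * τ) * √2 + 1, by positivity, fun p => ?_⟩
    have h3 := hC.costBody.inner_le_of_mem_smul (inputMapAdj S B T p) (Real.sqrt_nonneg _) h1
    rw [inputMapAdj, ContinuousLinearMap.adjoint_inner_left, huy, real_inner_comm] at h3
    have h4 : supportReal (ConicControl.costBody C T) (inputMapAdj S B T p) =
        √2 * dualNorm S B T C p := by
      rw [dualNorm, mul_div_cancel₀ _ h20.ne']
    have h5 := hC.dualNorm_nonneg S B T p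
    rw [inputMapAdj] at h4
    rw [h4] at h3
    linarith
  · rintro ⟨c, hc, h⟩
    obtain ⟨u, hu, huy⟩ := hC.costBody.exists_mem_smul_map_eq (inputMap S B T) (s := c / √2)
      (y := shiftedTarget S T y₀ yf) fun p => by
        refine (h p).trans_eq ?_
        rw [dualNorm, inputMapAdj]
        ring
    rw [← hC.cost_le_iff (by positivity)] at hu
    have hfin : cost C T u < ⊤ := hu.trans_lt ENNReal.ofReal_lt_top
    refine ⟨u, hfin, ?_, huy⟩
    have hint : ∫⁻ t in Ioo 0 T, gaugeFun C (u t) ^ 2 ≠ ⊤ := by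
      intro h
      rw [cost, h, ENNReal.mul_top (by norm_num)] at hfin
      exact lt_irrefl _ hfin
    filter_upwards [ae_lt_top ((hC.measurable_gaugeFun_comp u).pow_const 2) hint] with t ht
    refine hC.mem_coneOf_of_gaugeFun_ne_top fun htop => ?_
    simp [htop] at ht

/-- Some subgradient of the dual cost at a dual minimiser steers to the target. -/
theorem exists_mem_dualityMap_steers {c : ℝ} (hc : DualBound S B T C y₀ yf c) {p : X}
    (hp : IsDualMinimiser S B T C y₀ yf p) :
    ∃ u ∈ dualityMap (ConicControl.costBody C T) (inputMapAdj S B T p),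
      Steers S B T y₀ yf u := by
  obtain ⟨h1, h2⟩ := inner_eq_and_le_of_isMin (hC.dualNorm_nonneg S B T)
    (hC.dualNorm_smul S B T) ((hC.dualBound_iff S B T y₀ yf c).1 hc)
    ((hC.isDualMinimiser_iff S B T y₀ yf p).1 hp)
  have h20 : √(2 : ℝ) * √2 = 2 := Real.mul_self_sqrt two_pos.le
  -- The two factors `1 / √2` in `2 N(p) N(p')` cancel the `2`, so the optimality bound is the
  -- separation hypothesis with `s = σ_K(L_T^* p)`.
  obtain ⟨u, hu, huy⟩ := hC.costBody.exists_mem_smul_map_eq (inputMap S B T)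
    (s := supportReal (ConicControl.costBody C T) (inputMapAdj S B T p))
    (y := shiftedTarget S T y₀ yf) fun p' => by
      refine (h2 p').trans_eq ?_
      rw [dualNorm, dualNorm, inputMapAdj]
      field_simp
      rw [sq, h20]
      ring
  refine ⟨u, ⟨hu, ?_⟩, (steers_iff S B T y₀ yf u).2 huy⟩
  -- Steering alone fixes the product: `⟪u, L_T^* p⟫ = ⟪y, p⟫ = 2 N(p)² = σ_K(L_T^* p)²`.
  rw [inputMapAdj, ContinuousLinearMap.adjoint_inner_right, huy, h1, dualNorm_sq, inputMapAdj]
  ring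

end IsConvexBody

end Duality

end ConicControl

/-! ### The theorem -/

theorem theorem2 {X U : Type*}
    [NormedAddCommGroup X] [InnerProductSpace ℝ X] [CompleteSpace X] [Nontrivial X]
    [NormedAddCommGroup U] [InnerProductSpace ℝ U] [CompleteSpace U]
    (A : X →ₗ.[ℝ] X) (S : C0Semigroup X) (hA : S.IsGenerator A) (B : U →L[ℝ] X)
    (T : ℝ) (hT : 0 < T) (𝒰 : Set U) (hbdd : Bornology.IsBounded 𝒰) (hzero : (0 : U) ∈ 𝒰)
    (y₀ yf : X) :
    -- exact reachability criterion
    (ExactlyReachable S B T (coneOf (relaxed 𝒰)) (finiteCost (relaxed 𝒰) T) y₀ yf ↔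
      ∃ c : ℝ, 0 < c ∧ DualBound S B T (relaxed 𝒰) y₀ yf c) ∧
    -- the two expressions of `c⋆` agree, and the criterion reads `c⋆ < +∞`
    cStar S B T (relaxed 𝒰) y₀ yf =
      (⨅ (c : ℝ) (_ : 0 ≤ c ∧ DualBound S B T (relaxed 𝒰) y₀ yf c), (c : EReal)) ∧
    ((∃ c : ℝ, 0 < c ∧ DualBound S B T (relaxed 𝒰) y₀ yf c) ↔
      cStar S B T (relaxed 𝒰) y₀ yf < ⊤) ∧
    -- consequences of the criterion
    ((∃ c : ℝ, 0 < c ∧ DualBound S B T (relaxed 𝒰) y₀ yf c) →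
      ((∃ p, IsDualMinimiser S B T (relaxed 𝒰) y₀ yf p) ↔
        CStarAttained S B T (relaxed 𝒰) y₀ yf) ∧
      ∀ p, IsDualMinimiser S B T (relaxed 𝒰) y₀ yf p →
        (∃ u ∈ subdifferential (dualCost (relaxed 𝒰) T) (inputMapAdj S B T p),
          Steers S B T y₀ yf u) ∧
        -- uniqueness if and only if (H); separability of `U` serves one direction only
        (CondH S B T (relaxed 𝒰) p →
          ∃! u, u ∈ subdifferential (dualCost (relaxed 𝒰) T) (inputMapAdj S B T p)) ∧
        (TopologicalSpace.SeparableSpace U →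
          (∃! u, u ∈ subdifferential (dualCost (relaxed 𝒰) T) (inputMapAdj S B T p)) →
          CondH S B T (relaxed 𝒰) p) ∧
        -- under (H) and (E) the unique control steers to the target with values in `cone 𝒰`
        (CondH S B T (relaxed 𝒰) p → (relaxed 𝒰).extremePoints ℝ ⊆ 𝒰 →
          ∃ u, subdifferential (dualCost (relaxed 𝒰) T) (inputMapAdj S B T p) = {u} ∧
            Steers S B T y₀ yf u ∧
            ∀ᵐ t ∂volume.restrict (Ioo 0 T), u t ∈ coneOf 𝒰)) := by
  have hC : IsConvexBody (relaxed 𝒰) := isConvexBody_relaxed hbdd hzero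
  have hN := hC.dualNorm_nonneg S B T
  have hs := hC.dualNorm_smul S B T
  have hcStar : cStar S B T (relaxed 𝒰) y₀ yf = ⨆ p ∈ Metric.sphere (0 : X) 1,
      quot ⟪shiftedTarget S T y₀ yf, p⟫ (dualNorm S B T (relaxed 𝒰) p : EReal) := by
    simp only [cStar, hC.dualQuot_eq]
  refine ⟨hC.exactlyReachable_iff S B T y₀ yf, ?_, ?_, fun hbound => ⟨?_, fun p hp => ?_⟩⟩
  · simp only [hcStar, hC.dualBound_iff]
    exact iSup_quot_eq_iInf hN hs
  · simp only [hcStar, hC.dualBound_iff]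
    exact exists_bound_iff_iSup_quot_lt_top hN hs
  · simp only [hC.dualBound_iff] at hbound
    simp only [CStarAttained, hcStar, hC.isDualMinimiser_iff, hC.dualQuot_eq]
    exact exists_isMin_iff_exists_quot_eq hN hs hbound
  · obtain ⟨c, -, hc⟩ := hbound
    obtain ⟨u, hu, huS⟩ := hC.exists_mem_dualityMap_steers S B T y₀ yf hc hp
    rw [hC.subdifferential_dualCost]
    refine ⟨⟨u, hu, huS⟩, fun hH => ⟨u, hu, fun v hv =>
      hC.subsingleton_dualityMap_costBody hH hv hu⟩, fun _ hunique => ?_, fun hH hext => ?_⟩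
    · obtain ⟨v, hv, hvu⟩ := hunique
      exact hC.ae_notMem_of_dualityMap_eq_singleton (eq_singleton_iff_unique_mem.2 ⟨hv, hvu⟩)
    · refine ⟨u, eq_singleton_iff_unique_mem.2 ⟨hu, fun v hv =>
        hC.subsingleton_dualityMap_costBody hH hv hu⟩, huS, ?_⟩
      filter_upwards [hH, hC.ae_mem_dualityMap hu] with t ht hut
      exact hC.mem_coneOf_of_mem_dualityMap hzero hext ht hut
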